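/- **Setting.** Let $T>0$, let $X,U,Y,Z$ be complex Hilbert spaces. A *system node* on $(X,U,Y)$ consists of a closed linear operator $A\&B:X\times U\supset\operatorname{dom}(A\&B)\to X$ and a linear operator $C\&D:\operatorname{dom}(A\&B)\to Y$, bounded for the graph norm of $A\&B$, such that for each $u\in U$ there is $x\in X$ with $(x,u)\in\operatorname{dom}(A\&B)$, and such that the main operator $Ax:=A\&B(x,0)$, $\operatorname{dom}A=\{x:(x,0)\in\operatorname{dom}(A\&B)\}$, generates a strongly continuous semigroup $\mathfrak A$ on $X$. Put $Cx:=C\&D(x,0)$ for $x\in\operatorname{dom}A$. Fix a real $\alpha$ such that $\alpha I-A$ is bijective, let $X_{-1}$ be the completion of $X$ for the norm $\|(\alpha I-A)^{-1}x\|$, let $A_{-1}:X\to X_{-1}$ and $\mathfrak A_{-1}(t):X_{-1}\to X_{-1}$ be the extensions of $A$ and $\mathfrak A(t)$, and let $B\in L(U,X_{-1})$ be the operator for which $[A_{-1}\ B]$ extends $A\&B$. Let $B^*:\operatorname{dom}(A^*)\to U$ be its adjoint with respect to the pivot space $X$. Let $H^2_{0l}$ ($H^2_{0r}$) be the space of $H^2$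 functions on $[0,T]$ that vanish together with their derivative at $0$ (at $T$), let $H^{-2}_{0l}([0,T];Y)$ be the anti-dual of $H^2_{0r}([0,T];Y)$, which contains $L^2([0,T];Y)$ by means of the $L^2$ inner product, and for $v\in L^2([0,T];Y)$ let $\big(\tfrac{d^2}{dt^2}\big)_l v\in H^{-2}_{0l}([0,T];Y)$ be the functional $w\mapsto\langle v,w''\rangle_{L^2}$. Define $$\mathfrak B_tu=\int_0^t\mathfrak A_{-1}(t-\tau)Bu(\tau)\,d\tau\in X_{-1},\qquad \mathfrak D_Tu=\big(\tfrac{d^2}{dt^2}\big)_l\,C\&D\int_0^\cdot(\cdot-\tau)\begin{pmatrix}\mathfrak B_\tau u\\u(\tau)\end{pmatrix}d\tau\in H^{-2}_{0l}([0,T];Y)$$ for $u\in L^2([0,T];U)$, and $\mathfrak C_Tx=\big(\tfrac{d^2}{dt^2}\big)_l\,C\int_0^\cdot(\cdot-\tau)\mathfrak A(\tau)x\,d\tau$ for $x\in X$. If $\mathfrak C_T$, as an operator from $X_{-1}\supset X$ to $H^{-2}_{0l}([0,T];Y)$, is closable, then $\mathfrak C_T$ also denotes its closure (in particular its bounded extension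 to $X_{-1}$, if it is bounded for the norm of $X_{-1}$); otherwise its domain is $X$. Let $F\in L(X,Z)$. For $x_0\in X_{-1}$, $u\in L^2([0,T];U)$, $z\in Z$ write $z\in\mathfrak T_{F,T}(x_0,u)$ if there are $u_n\to u$ in $L^2([0,T];U)$ with $x_n:=\mathfrak A_{-1}(T)x_0+\mathfrak B_Tu_n\in X$ and $Fx_n\to z$; $(x_0,u)\in\operatorname{dom}(\mathfrak T_{F,T})$ means that such a $z$ exists. (If $(x_0,u)\mapsto F(\mathfrak A_{-1}(T)x_0+\mathfrak B_Tu)$ is closable with respect to $u$, then $z$ is unique and $\mathfrak T_{F,T}$ is a map; otherwise it is a multi-valued map.) The *$F$-input map* $\mathfrak I_{F,T}$ is given by $(z,y)\in\mathfrak I_{F,T}u$ iff $z\in\mathfrak T_{F,T}(0,u)$ and $y=\mathfrak D_Tu\in L^2([0,T];Y)$; it is *injective* if $\mathfrak I_{F,T}u$ and $\mathfrak I_{F,T}v$ have no common element for $u\ne v$. A *classical trajectory* on $[0,T]$ is $(x,u,y)\in C^1([0,T];X)\times C([0,T];U)\times C([0,T];Y)$ with $(x(t),u(t))\in\operatorname{dom}(A\&B)$,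 $\dot x(t)=A\&B(x(t),u(t))$ and $y(t)=C\&D(x(t),u(t))$ for all $t\in[0,T]$; a *generalized trajectory* is a limit of classical ones in $C([0,T];X)\times L^2([0,T];U)\times L^2([0,T];Y)$. **Assumptions.** (a) $(A\&B,C\&D)$ is a system node on $(X,U,Y)$. (b) $F\in L(X,Z)$, and the set of all $w\in Z$ with $B^*\int_0^\cdot(\cdot-\tau)\mathfrak A(\tau)^*F^*w\,d\tau\in H^2_{0l}([0,T];U)$ is dense in $Z$. (c) $x_0\in X_{-1}$, $z_f\in Z$, $y_{\rm ref}\in L^2([0,T];Y)$. (d) $\mathcal U_{\rm ad}\subset L^2([0,T];U)$ is closed and convex. (e) At least one of the following holds: (i) $\mathcal U_{\rm ad}$ is bounded; (ii) there is $c>0$ such that every generalized trajectory $(x,u,y)$ with $x(0)=0$ satisfies $\|y\|^2_{L^2}+\|Fx(T)\|_Z\ge c\|u\|^2_{L^2}$; (iii) there is $c>0$ such that $\|y\|^2_{L^2}+\|z\|_Z^2\ge c\|u\|_{L^2}^2$ for all $u\in L^2([0,T];U)$ and all $(z,y)\in\mathfrak I_{F,T}u$. (f) There is $\hat u\in\mathcal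 U_{\rm ad}$ such that $(x_0,\hat u)\in\operatorname{dom}(\mathfrak T_{F,T})$, $x_0\in\operatorname{dom}(\mathfrak C_T)$ and $\mathfrak C_Tx_0+\mathfrak D_T\hat u\in L^2([0,T];Y)$. For $u\in L^2([0,T];U)$ let $\mathcal J(u)\in[0,\infty]$ be $$\mathcal J(u)=\inf_{z\in\mathfrak T_{F,T}(x_0,u)}\tfrac12\Big(\|z-z_f\|_Z^2+\|\mathfrak C_Tx_0+\mathfrak D_Tu-y_{\rm ref}\|^2_{L^2([0,T];Y)}\Big)$$ if $(x_0,u)\in\operatorname{dom}(\mathfrak T_{F,T})$ and $\mathfrak C_Tx_0+\mathfrak D_Tu\in L^2([0,T];Y)$, and $\mathcal J(u)=\infty$ otherwise. An *optimal control* is $u_{\rm opt}\in\mathcal U_{\rm ad}$ with $\mathcal J(u_{\rm opt})=\inf_{u\in\mathcal U_{\rm ad}}\mathcal J(u)$. **Theorem (Uniqueness of optimal controls).** Under the assumptions (a)-(f), if the $F$-input map $\mathfrak I_{F,T}$ is injective, then there exists exactly one optimal control. -/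

import Mathlib

open MeasureTheory Set Filter Topology
open scoped ENNReal NNReal

noncomputable section

namespace OptControl

/-! ### Function spaces on `[0, T]` -/

/-- `L²([0,T]; E)`. -/
abbrev L2 (T : ℝ) (E : Type*) [NormedAddCommGroup E] : Type _ :=
  Lp E 2 (volume.restrict (Icc (0 : ℝ) T))

section FunctionSpaces

variable {T : ℝ} {E : Type*} [NormedAddCommGroup E]

theorem L2.intervalIntegrable (f : L2 T E) {a b : ℝ} (ha : a ∈ Icc 0 T) (hb : b ∈ Icc 0 T) :
    IntervalIntegrable f volume a b := by
  have h : IntegrableOn f (Icc 0 T) volume := (Lp.memLp f).integrable (by norm_num)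
  exact (h.mono_set (uIcc_subset_Icc ha hb)).intervalIntegrable

theorem ae_uIoc_of_ae_Icc {p : ℝ → Prop} (h : ∀ᵐ s ∂(volume.restrict (Icc (0 : ℝ) T)), p s)
    {a b : ℝ} (ha : a ∈ Icc 0 T) (hb : b ∈ Icc 0 T) : ∀ᵐ s, s ∈ uIoc a b → p s := by
  filter_upwards [(ae_restrict_iff' measurableSet_Icc).1 h] with s hs hs'
  exact hs (uIcc_subset_Icc ha hb (uIoc_subset_uIcc hs'))

variable [InnerProductSpace ℂ E]

/-- Almost everywhere on `[0,T]`, `g` is the primitive of `f` that vanishes at `a`; in other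
words `g` is absolutely continuous with weak derivative `f` and `g(a) = 0`. -/
def IsPrimitiveFrom (a : ℝ) (g f : L2 T E) : Prop :=
  g =ᵐ[volume.restrict (Icc (0 : ℝ) T)] fun t => ∫ s in a..t, f s

theorem IsPrimitiveFrom.zero (a : ℝ) (ha : ∀ t ∈ Icc 0 T, a ∈ Icc 0 T) :
    IsPrimitiveFrom a (0 : L2 T E) 0 := by
  have h := Lp.coeFn_zero E 2 (volume.restrict (Icc (0 : ℝ) T))
  filter_upwards [h, ae_restrict_mem measurableSet_Icc] with t ht htm
  rw [ht, intervalIntegral.integral_congr_ae (ae_uIoc_of_ae_Icc h (ha t htm) htm)]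
  simp

theorem IsPrimitiveFrom.add {a : ℝ} (ha : ∀ t ∈ Icc 0 T, a ∈ Icc 0 T) {g g' f f' : L2 T E}
    (h : IsPrimitiveFrom a g f) (h' : IsPrimitiveFrom a g' f') :
    IsPrimitiveFrom a (g + g') (f + f') := by
  filter_upwards [Lp.coeFn_add g g', h, h', ae_restrict_mem measurableSet_Icc] with t ht h1 h2 htm
  rw [ht, intervalIntegral.integral_congr_ae
    (ae_uIoc_of_ae_Icc (Lp.coeFn_add f f') (ha t htm) htm), Pi.add_apply, h1, h2,
    ← intervalIntegral.integral_add (f.intervalIntegrable (ha t htm) htm)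
      (f'.intervalIntegrable (ha t htm) htm)]
  rfl

theorem IsPrimitiveFrom.smul {a : ℝ} (ha : ∀ t ∈ Icc 0 T, a ∈ Icc 0 T) {g f : L2 T E}
    (c : ℂ) (h : IsPrimitiveFrom a g f) : IsPrimitiveFrom a (c • g) (c • f) := by
  filter_upwards [Lp.coeFn_smul c g, h, ae_restrict_mem measurableSet_Icc] with t ht h1 htm
  rw [ht, intervalIntegral.integral_congr_ae
    (ae_uIoc_of_ae_Icc (Lp.coeFn_smul c f) (ha t htm) htm), Pi.smul_apply, h1,
    ← intervalIntegral.integral_smul]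
  rfl

/-- Triples `(v, v', v'')` with `v ∈ H²([0,T]; E)` and `v(a) = v'(a) = 0`. As a subspace of
`L² × L² × L²` (with the `ℓ²` norm) it carries the usual `H²` norm. -/
def H2Vanishing (T : ℝ) (E : Type*) [NormedAddCommGroup E] [InnerProductSpace ℂ E]
    (a : ℝ) (ha : ∀ t ∈ Icc 0 T, a ∈ Icc 0 T) :
    Submodule ℂ (PiLp 2 fun _ : Fin 3 => L2 T E) where
  carrier := {v | IsPrimitiveFrom a (v 1) (v 2) ∧ IsPrimitiveFrom a (v 0) (v 1)}
  zero_mem' := ⟨IsPrimitiveFrom.zero a ha, IsPrimitiveFrom.zero a ha⟩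
  add_mem' h h' := ⟨h.1.add ha h'.1, h.2.add ha h'.2⟩
  smul_mem' c _ h := ⟨h.1.smul ha c, h.2.smul ha c⟩

/-- `H²_{0l}([0,T]; E)`: both `v` and `v'` vanish at the left end point `0`. -/
abbrev H20l (T : ℝ) (E : Type*) [NormedAddCommGroup E] [InnerProductSpace ℂ E] :
    Submodule ℂ (PiLp 2 fun _ : Fin 3 => L2 T E) :=
  H2Vanishing T E 0 fun _ ht => ⟨le_rfl, ht.1.trans ht.2⟩

/-- `H²_{0r}([0,T]; E)`: both `v` and `v'` vanish at the right end point `T`. -/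
abbrev H20r (T : ℝ) (E : Type*) [NormedAddCommGroup E] [InnerProductSpace ℂ E] :
    Submodule ℂ (PiLp 2 fun _ : Fin 3 => L2 T E) :=
  H2Vanishing T E T fun _ ht => ⟨ht.1.trans ht.2, le_rfl⟩

/-- `H⁻²_{0l}([0,T]; E)`, the anti-dual of `H²_{0r}([0,T]; E)`. -/
abbrev Hm20l (T : ℝ) (E : Type*) [NormedAddCommGroup E] [InnerProductSpace ℂ E] : Type _ :=
  H20r T E →L⋆[ℂ] ℂ

/-- The functional `w ↦ ⟨v, w⁽ᵏ⁾⟩_{L²}` on `H²_{0r}` (the product is linear in `v`). -/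
def pairDeriv (k : Fin 3) : L2 T E →ₗ[ℂ] Hm20l T E where
  toFun v := ((innerSL ℂ (E := L2 T E)).flip v).comp
    ((PiLp.proj 2 (𝕜 := ℂ) (fun _ : Fin 3 => L2 T E) k).comp (H20r T E).subtypeL)
  map_add' v w := by ext; simp
  map_smul' c v := by ext; simp

/-- The embedding of `L²([0,T]; E)` into `H⁻²_{0l}([0,T]; E)`. -/
def embedL2 : L2 T E →ₗ[ℂ] Hm20l T E := pairDeriv 0

/-- The second derivative `L²([0,T]; E) → H⁻²_{0l}([0,T]; E)`, `⟨v'', w⟩ := ⟨v, w''⟩`. -/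
def secondDeriv : L2 T E →ₗ[ℂ] Hm20l T E := pairDeriv 2

theorem embedL2_apply (v : L2 T E) (w : H20r T E) :
    embedL2 v w = inner ℂ ((w : PiLp 2 fun _ : Fin 3 => L2 T E) 0) v := rfl

theorem secondDeriv_apply (v : L2 T E) (w : H20r T E) :
    secondDeriv v w = inner ℂ ((w : PiLp 2 fun _ : Fin 3 => L2 T E) 2) v := rfl

end FunctionSpaces

/-! ### Strongly continuous semigroups -/

/-- A strongly continuous one-parameter semigroup of bounded operators. -/
structure C0Semigroup (X : Type*) [NormedAddCommGroup X] [NormedSpace ℂ X] where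
  op : ℝ≥0 → X →L[ℂ] X
  op_zero : op 0 = 1
  op_add : ∀ s t, op (s + t) = (op s).comp (op t)
  continuous_op : ∀ x, Continuous fun t => op t x

namespace C0Semigroup

variable {X : Type*} [NormedAddCommGroup X] [NormedSpace ℂ X] (𝔄 : C0Semigroup X)

/-- `A` is the generator: `x ∈ dom A` with `A x = y` iff `(𝔄(t) x - x) / t → y` as `t ↓ 0`. -/
def IsGenerator (A : X →ₗ.[ℂ] X) : Prop :=
  ∀ x y : X, (x, y) ∈ A.graph ↔
    Tendsto (fun t : ℝ => t⁻¹ • (𝔄.op t.toNNReal x - x)) (𝓝[>] 0) (𝓝 y)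

theorem continuous_orbit (x : X) : Continuous fun t : ℝ => 𝔄.op t.toNNReal x :=
  (𝔄.continuous_op x).comp continuous_real_toNNReal

theorem op_comm (s t : ℝ≥0) (x : X) : 𝔄.op s (𝔄.op t x) = 𝔄.op t (𝔄.op s x) := by
  rw [← ContinuousLinearMap.comp_apply, ← 𝔄.op_add, add_comm, 𝔄.op_add]; rfl

variable {𝔄} {A : X →ₗ.[ℂ] X}

theorem IsGenerator.op_graph (hA : 𝔄.IsGenerator A) {x y : X} (h : (x, y) ∈ A.graph) (t : ℝ≥0) :
    (𝔄.op t x, 𝔄.op t y) ∈ A.graph := by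
  rw [hA] at h ⊢
  have h1 := ((𝔄.op t).continuous.tendsto y).comp h
  refine h1.congr fun s => ?_
  simp only [Function.comp_apply]
  rw [ContinuousLinearMap.map_smul_of_tower, map_sub, 𝔄.op_comm t]

variable [CompleteSpace X]

theorem IsGenerator.integral_graph (hA : 𝔄.IsGenerator A) (x : X) {h : ℝ} (hh : 0 ≤ h) :
    (∫ s in (0 : ℝ)..h, 𝔄.op s.toNNReal x, 𝔄.op h.toNNReal x - x) ∈ A.graph := by
  rw [hA]
  have hc := 𝔄.continuous_orbit x
  have hd : ∀ u : ℝ, Tendsto (fun t : ℝ => t⁻¹ • ((∫ s in (0 : ℝ)..(u + t), 𝔄.op s.toNNReal x) -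
      ∫ s in (0 : ℝ)..u, 𝔄.op s.toNNReal x)) (𝓝[>] 0) (𝓝 (𝔄.op u.toNNReal x)) := fun u =>
    ((hasDerivAt_iff_tendsto_slope_zero.1 (hc.integral_hasStrictDerivAt 0 u).hasDerivAt).mono_left
      (nhdsWithin_mono _ fun t ht => ne_of_gt ht))
  have h0 := (hd h).sub (hd 0)
  rw [Real.toNNReal_zero, 𝔄.op_zero] at h0
  refine h0.congr' ?_
  filter_upwards [self_mem_nhdsWithin] with t ht
  have ht : 0 < t := ht
  have hi : ∀ a b : ℝ, IntervalIntegrable (fun s : ℝ => 𝔄.op s.toNNReal x) volume a b :=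
    fun a b => hc.intervalIntegrable a b
  rw [← ContinuousLinearMap.intervalIntegral_comp_comm _ (hi 0 h), ← smul_sub]
  congr 1
  have h2 : (∫ s in (0 : ℝ)..h, 𝔄.op t.toNNReal (𝔄.op s.toNNReal x)) =
      ∫ s in (0 : ℝ)..h, 𝔄.op (s + t).toNNReal x := by
    refine intervalIntegral.integral_congr fun s hs => ?_
    rw [uIcc_of_le hh] at hs
    rw [add_comm s t, Real.toNNReal_add ht.le hs.1, 𝔄.op_add]; rfl
  rw [h2, intervalIntegral.integral_comp_add_right (fun s => 𝔄.op s.toNNReal x)]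
  have e1 := intervalIntegral.integral_add_adjacent_intervals (hi 0 t) (hi t (h + t))
  simp only [zero_add, intervalIntegral.integral_same, sub_zero]
  rw [← e1]
  abel

theorem IsGenerator.dense_domain (hA : 𝔄.IsGenerator A) : Dense (A.domain : Set X) := by
  intro x
  have hc := 𝔄.continuous_orbit x
  have hd := ((hasDerivAt_iff_tendsto_slope_zero.1
    (hc.integral_hasStrictDerivAt 0 0).hasDerivAt).mono_left
      (nhdsWithin_mono (0 : ℝ) (s := Ioi 0) fun t ht => ne_of_gt ht))
  simp only [Real.toNNReal_zero, 𝔄.op_zero, zero_add, intervalIntegral.integral_same,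
    sub_zero] at hd
  refine mem_closure_of_tendsto hd ?_
  filter_upwards [self_mem_nhdsWithin] with t ht
  have h1 := LinearPMap.mem_domain_of_mem_graph (hA.integral_graph x (le_of_lt ht))
  have := A.domain.smul_mem ((t⁻¹ : ℝ) : ℂ) h1
  rwa [Complex.coe_smul] at this

end C0Semigroup

/-! ### System nodes -/

/-- The main operator: `dom A = {x | (x, 0) ∈ dom A&B}` and `A x = A&B (x, 0)`. -/
def mainOperator {X U : Type*} [NormedAddCommGroup X] [NormedSpace ℂ X]
    [NormedAddCommGroup U] [NormedSpace ℂ U] (AB : (X × U) →ₗ.[ℂ] X) : X →ₗ.[ℂ] X where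
  domain := AB.domain.comap (LinearMap.inl ℂ X U)
  toFun := AB.toFun ∘ₗ (LinearMap.inl ℂ X U).submoduleComap AB.domain

/-- A system node `S = [A&B; C&D]` on `(X, U, Y)`. The semigroup is determined by its
generator; it is stored as a field for convenience. -/
structure SystemNode (X U Y : Type*)
    [NormedAddCommGroup X] [InnerProductSpace ℂ X] [CompleteSpace X]
    [NormedAddCommGroup U] [InnerProductSpace ℂ U] [CompleteSpace U]
    [NormedAddCommGroup Y] [InnerProductSpace ℂ Y] [CompleteSpace Y] where
  AB : (X × U) →ₗ.[ℂ] X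
  CD : AB.domain →ₗ[ℂ] Y
  isClosed : AB.IsClosed
  /-- `C&D` is bounded for the graph norm of `A&B`. -/
  bounded_CD : ∃ K : ℝ, ∀ p : AB.domain, ‖CD p‖ ≤ K * (‖(p : X × U)‖ + ‖AB p‖)
  exists_mem : ∀ u : U, ∃ x : X, (x, u) ∈ AB.domain
  semigroup : C0Semigroup X
  isGenerator : semigroup.IsGenerator (mainOperator AB)

namespace SystemNode

variable {X U Y Z : Type*}
  [NormedAddCommGroup X] [InnerProductSpace ℂ X] [CompleteSpace X]
  [NormedAddCommGroup U] [InnerProductSpace ℂ U] [CompleteSpace U]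
  [NormedAddCommGroup Y] [InnerProductSpace ℂ Y] [CompleteSpace Y]
  [NormedAddCommGroup Z] [InnerProductSpace ℂ Z] [CompleteSpace Z]
  (S : SystemNode X U Y)

/-- The main operator `A`. -/
def A : X →ₗ.[ℂ] X := mainOperator S.AB

/-- The operator `C` on `dom A`, `C x = C&D (x, 0)`. -/
def C : S.A.domain →ₗ[ℂ] Y := S.CD ∘ₗ (LinearMap.inl ℂ X U).submoduleComap S.AB.domain

theorem mem_graph_A {x y : X} : (x, y) ∈ S.A.graph ↔ ((x, (0 : U)), y) ∈ S.AB.graph := by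
  simp only [LinearPMap.mem_graph_iff]
  constructor
  · rintro ⟨z, rfl, rfl⟩
    exact ⟨⟨((z : X), 0), z.2⟩, rfl, rfl⟩
  · rintro ⟨⟨z, hz⟩, h, rfl⟩
    simp only at h
    subst h
    exact ⟨⟨x, hz⟩, rfl, rfl⟩

theorem isClosed_graph_A : IsClosed (S.A.graph : Set (X × X)) := by
  have h : (S.A.graph : Set (X × X)) =
      (fun p : X × X => ((p.1, (0 : U)), p.2)) ⁻¹' (S.AB.graph : Set ((X × U) × X)) := by
    ext ⟨x, y⟩
    exact S.mem_graph_A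
  rw [h]
  exact IsClosed.preimage (by fun_prop) S.isClosed

/-- The real numbers `α` for which `α I - A : dom A → X` is bijective. -/
def ResolventPoint : Type :=
  {α : ℝ // Function.Bijective fun x : S.A.domain => (α : ℂ) • (x : X) - S.A x}

variable {S} (α : S.ResolventPoint)

/-- `α I - A` as a linear bijection from `dom A` onto `X`. -/
def shiftEquiv : S.A.domain ≃ₗ[ℂ] X :=
  LinearEquiv.ofBijective ((α.1 : ℂ) • S.A.domain.subtype - S.A.toFun) α.2

theorem shiftEquiv_apply (x : S.A.domain) : shiftEquiv α x = (α.1 : ℂ) • (x : X) - S.A x := rfl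

theorem mem_graph_iff_shift {x y : X} :
    (x, y) ∈ S.A.graph ↔ (((shiftEquiv α).symm ((α.1 : ℂ) • x - y) : S.A.domain) : X) = x := by
  constructor
  · intro h
    obtain ⟨z, rfl, rfl⟩ := (LinearPMap.mem_graph_iff _).1 h
    rw [← shiftEquiv_apply, LinearEquiv.symm_apply_apply]
  · intro h
    have h2 := shiftEquiv_apply α ((shiftEquiv α).symm ((α.1 : ℂ) • x - y))
    rw [LinearEquiv.apply_symm_apply, h] at h2
    refine (LinearPMap.mem_graph_iff _).2 ⟨_, h, ?_⟩
    exact (sub_right_injective h2).symm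

/-- The resolvent `(α I - A)⁻¹`, a bounded operator on `X`. -/
def resolvent : X →L[ℂ] X :=
  ContinuousLinearMap.ofIsClosedGraph
    (g := S.A.domain.subtype ∘ₗ ((shiftEquiv α).symm : X →ₗ[ℂ] S.A.domain)) (by
      have h : ((S.A.domain.subtype ∘ₗ ((shiftEquiv α).symm : X →ₗ[ℂ] S.A.domain)).graph :
          Set (X × X)) = (fun p : X × X => (p.2, (α.1 : ℂ) • p.2 - p.1)) ⁻¹'
            (S.A.graph : Set (X × X)) := by
        ext ⟨x, y⟩
        simp only [SetLike.mem_coe, LinearMap.mem_graph_iff, mem_preimage, mem_graph_iff_shift α]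
        simp [eq_comm]
      rw [h]
      exact IsClosed.preimage (by fun_prop) S.isClosed_graph_A)

theorem resolvent_apply (x : X) :
    resolvent α x = (((shiftEquiv α).symm x : S.A.domain) : X) := rfl

theorem resolvent_mem (x : X) : resolvent α x ∈ S.A.domain := ((shiftEquiv α).symm x).2

theorem mem_graph_iff_resolvent {x y : X} :
    (x, y) ∈ S.A.graph ↔ resolvent α ((α.1 : ℂ) • x - y) = x := mem_graph_iff_shift α

theorem resolvent_injective : Function.Injective (resolvent α) := fun _ _ h =>
  (shiftEquiv α).symm.injective (Subtype.ext h)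

theorem resolvent_graph (x : X) :
    (resolvent α x, (α.1 : ℂ) • resolvent α x - x) ∈ S.A.graph := by
  rw [mem_graph_iff_resolvent α, sub_sub_cancel]

theorem resolvent_op (t : ℝ≥0) (x : X) :
    resolvent α (S.semigroup.op t x) = S.semigroup.op t (resolvent α x) := by
  have h := S.isGenerator.op_graph (resolvent_graph α x) t
  have h2 := (mem_graph_iff_resolvent α).1 h
  rwa [← map_smul, ← map_sub, sub_sub_cancel] at h2

/-! ### The extrapolation space `X₋₁` -/

/-- The extrapolation space `X₋₁`: the completion of `X` for the norm `‖(α I - A)⁻¹ x‖`.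
It is realised through the isometric isomorphism `α I - A₋₁ : X → X₋₁`, that is, the vector
`r` of the underlying Hilbert space `X` stands for the element `(α I - A₋₁) r` of `X₋₁`. The
canonical embedding of `X` is `toExtrap`; by `norm_toExtrap` and `denseRange_toExtrap` the
space is the completion of `X` for the norm above. -/
def Extrap (_ : S.ResolventPoint) : Type _ := X

instance : NormedAddCommGroup (Extrap α) := inferInstanceAs (NormedAddCommGroup X)
instance : InnerProductSpace ℂ (Extrap α) := inferInstanceAs (InnerProductSpace ℂ X)
instance : CompleteSpace (Extrap α) := inferInstanceAs (CompleteSpace X)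

/-- The isometric isomorphism `α I - A₋₁ : X → X₋₁`. -/
def shiftExtrap : X ≃ₗᵢ[ℂ] Extrap α := LinearIsometryEquiv.refl ℂ X

/-- The canonical embedding `X → X₋₁`. -/
def toExtrap : X →L[ℂ] Extrap α :=
  (shiftExtrap α : X →L[ℂ] Extrap α).comp (resolvent α)

theorem norm_toExtrap (x : X) : ‖toExtrap α x‖ = ‖resolvent α x‖ :=
  (shiftExtrap α).norm_map _

theorem toExtrap_injective : Function.Injective (toExtrap α) :=
  (shiftExtrap α).injective.comp (resolvent_injective α)

theorem denseRange_toExtrap : DenseRange (toExtrap α) := by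
  have h : range (resolvent α) = (S.A.domain : Set X) := by
    ext x
    constructor
    · rintro ⟨y, rfl⟩
      exact resolvent_mem α y
    · intro hx
      exact ⟨_, (mem_graph_iff_resolvent α).1 (LinearPMap.mem_graph _ ⟨x, hx⟩)⟩
  have h2 : DenseRange (resolvent α) := by
    unfold DenseRange
    rw [h]
    exact S.isGenerator.dense_domain
  exact (shiftExtrap α).surjective.denseRange.comp h2 (shiftExtrap α).continuous

/-- The extension `A₋₁ : X → X₋₁` of the main operator. -/
def extA : X →L[ℂ] Extrap α :=
  (α.1 : ℂ) • toExtrap α - (shiftExtrap α : X →L[ℂ] Extrap α)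

theorem extA_apply (x : S.A.domain) : extA α (x : X) = toExtrap α (S.A x) := by
  have h := (mem_graph_iff_resolvent α).1 (LinearPMap.mem_graph S.A x)
  rw [map_sub, map_smul] at h
  change (α.1 : ℂ) • resolvent α (x : X) - (x : X) = resolvent α (S.A x)
  rw [sub_eq_iff_eq_add, ← sub_eq_iff_eq_add', h]

/-- The semigroup `𝔄₋₁` on `X₋₁` that extends `𝔄`. -/
def extOp (t : ℝ≥0) : Extrap α →L[ℂ] Extrap α :=
  ((shiftExtrap α : X →L[ℂ] Extrap α).comp (S.semigroup.op t)).comp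
    ((shiftExtrap α).symm : Extrap α →L[ℂ] X)

theorem extOp_toExtrap (t : ℝ≥0) (x : X) :
    extOp α t (toExtrap α x) = toExtrap α (S.semigroup.op t x) :=
  (resolvent_op α t x).symm

/-! ### The control operator -/

theorem exists_control (u : U) : ∃ b : Extrap α, ∀ x (h : (x, u) ∈ S.AB.domain),
    toExtrap α (S.AB ⟨(x, u), h⟩) = extA α x + b := by
  obtain ⟨x₀, h₀⟩ := S.exists_mem u
  refine ⟨toExtrap α (S.AB ⟨(x₀, u), h₀⟩) - extA α x₀, fun x h => ?_⟩
  have hm : (x - x₀, S.AB ⟨(x, u), h⟩ - S.AB ⟨(x₀, u), h₀⟩) ∈ S.A.graph := by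
    rw [mem_graph_A]
    have := S.AB.graph.sub_mem (LinearPMap.mem_graph S.AB ⟨(x, u), h⟩)
      (LinearPMap.mem_graph S.AB ⟨(x₀, u), h₀⟩)
    simpa using this
  obtain ⟨z, hz, hz'⟩ := (LinearPMap.mem_graph_iff _).1 hm
  have h3 := extA_apply α z
  simp only at hz hz'
  rw [hz, hz', map_sub, map_sub] at h3
  rw [← sub_eq_iff_eq_add', sub_eq_sub_iff_sub_eq_sub, ← h3]

/-- The vector `B u ∈ X₋₁`. -/
def controlFun (u : U) : Extrap α := (exists_control α u).choose

theorem controlFun_spec {u : U} {x : X} (h : (x, u) ∈ S.AB.domain) :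
    toExtrap α (S.AB ⟨(x, u), h⟩) = extA α x + controlFun α u :=
  (exists_control α u).choose_spec x h

theorem controlFun_eq {u : U} {x : X} (h : (x, u) ∈ S.AB.domain) :
    controlFun α u = toExtrap α (S.AB ⟨(x, u), h⟩) - extA α x := by
  rw [controlFun_spec, add_sub_cancel_left]

/-- `B` as a linear map. -/
def controlLin : U →ₗ[ℂ] Extrap α where
  toFun := controlFun α
  map_add' u v := by
    obtain ⟨x, hx⟩ := S.exists_mem u
    obtain ⟨y, hy⟩ := S.exists_mem v
    have hxy : (x + y, u + v) ∈ S.AB.domain := S.AB.domain.add_mem hx hy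
    have h : S.AB ⟨(x + y, u + v), hxy⟩ = S.AB ⟨(x, u), hx⟩ + S.AB ⟨(y, v), hy⟩ :=
      S.AB.map_add ⟨(x, u), hx⟩ ⟨(y, v), hy⟩
    rw [controlFun_eq α hx, controlFun_eq α hy, controlFun_eq α hxy, h, map_add, map_add]
    abel
  map_smul' c u := by
    obtain ⟨x, hx⟩ := S.exists_mem u
    have hcx : (c • x, c • u) ∈ S.AB.domain := S.AB.domain.smul_mem c hx
    have h : S.AB ⟨(c • x, c • u), hcx⟩ = c • S.AB ⟨(x, u), hx⟩ :=
      S.AB.map_smul c ⟨(x, u), hx⟩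
    rw [controlFun_eq α hx, controlFun_eq α hcx, h, map_smul, map_smul, RingHom.id_apply, smul_sub]

theorem continuous_controlLin : Continuous (controlLin α) := by
  have : CompleteSpace S.AB.graph := S.isClosed.completeSpace_coe
  let p : S.AB.graph →L[ℂ] U :=
    ((ContinuousLinearMap.snd ℂ X U).comp (ContinuousLinearMap.fst ℂ (X × U) X)).comp
      S.AB.graph.subtypeL
  let q : S.AB.graph →L[ℂ] Extrap α :=
    ((toExtrap α).comp (ContinuousLinearMap.snd ℂ (X × U) X) -
      (extA α).comp ((ContinuousLinearMap.fst ℂ X U).comp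
        (ContinuousLinearMap.fst ℂ (X × U) X))).comp S.AB.graph.subtypeL
  have hp : Function.Surjective p := fun u => by
    obtain ⟨x, hx⟩ := S.exists_mem u
    exact ⟨⟨_, LinearPMap.mem_graph S.AB ⟨(x, u), hx⟩⟩, rfl⟩
  have hq : ⇑(controlLin α) ∘ p = q := by
    ext ⟨⟨⟨x, u⟩, y⟩, hg⟩
    obtain ⟨⟨z, hz⟩, h1, h2⟩ := (LinearPMap.mem_graph_iff _).1 hg
    simp only at h1 h2
    subst h1
    subst h2
    exact controlFun_eq α hz
  exact (p.isOpenMap hp).isQuotientMap p.continuous hp |>.continuous_iff.2 (hq ▸ q.continuous)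

/-- The control operator `B ∈ L(U, X₋₁)`; it is characterised by `control_spec`, which says
that `[A₋₁ B]` extends `A&B`. -/
def control : U →L[ℂ] Extrap α := ⟨controlLin α, continuous_controlLin α⟩

theorem control_spec {u : U} {x : X} (h : (x, u) ∈ S.AB.domain) :
    toExtrap α (S.AB ⟨(x, u), h⟩) = extA α x + control α u :=
  controlFun_spec α h

/-- The adjoint `B^* : dom A^* → U`, for the duality with pivot space `X` between
`dom A^* = X_{d,1}` and `X₋₁`, in which `⟨z, (α I - A₋₁) r⟩ = ⟨(α I - A^*) z, r⟩_X`. -/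
def controlAdjoint : S.A.adjoint.domain →ₗ[ℂ] U :=
  (ContinuousLinearMap.adjoint
    (((shiftExtrap α).symm : Extrap α →L[ℂ] X).comp (control α)) : X →ₗ[ℂ] U) ∘ₗ
    ((α.1 : ℂ) • S.A.adjoint.domain.subtype - S.A.adjoint.toFun)

theorem inner_controlAdjoint (z : S.A.adjoint.domain) {x : X} {u : U}
    (h : (x, u) ∈ S.AB.domain) :
    inner ℂ (z : X) (S.AB ⟨(x, u), h⟩) =
      inner ℂ (S.A.adjoint z) x + inner ℂ (controlAdjoint α z) u := by
  have hspec : resolvent α (S.AB ⟨(x, u), h⟩) =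
      (α.1 : ℂ) • resolvent α x - x + (shiftExtrap α).symm (control α u) := control_spec α h
  set w := S.AB ⟨(x, u), h⟩
  set b : X := (shiftExtrap α).symm (control α u) with hb
  have hx : x = resolvent α ((α.1 : ℂ) • x - w) + b := by
    rw [map_sub, map_smul, hspec]
    abel
  have hg := resolvent_graph α ((α.1 : ℂ) • x - w)
  obtain ⟨a, ha, ha'⟩ := (LinearPMap.mem_graph_iff _).1 hg
  simp only at ha ha'
  rw [← ha] at hx ha'
  have hw : w = S.A a + (α.1 : ℂ) • b := by
    rw [ha', hx, smul_add]
    abel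
  have hadj : inner ℂ (S.A.adjoint z) (a : X) = inner ℂ (z : X) (S.A a) :=
    LinearPMap.adjoint_isFormalAdjoint S.isGenerator.dense_domain z a
  have hB : inner ℂ (controlAdjoint α z) u =
      inner ℂ ((α.1 : ℂ) • (z : X) - S.A.adjoint z) b := by
    change inner ℂ (ContinuousLinearMap.adjoint _ ((α.1 : ℂ) • (z : X) - S.A.adjoint z)) u = _
    rw [ContinuousLinearMap.adjoint_inner_left]
    rfl
  rw [hB, hw, inner_add_right, ← hadj, inner_sub_left, inner_smul_left, inner_smul_right,
    Complex.conj_ofReal]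
  conv_rhs => rw [hx, inner_add_right]
  ring

/-! ### The maps `𝔅_T`, `𝔗_{F,T}`, `ℭ_T`, `𝔇_T` and `ℑ_{F,T}` -/

/-- The second integral `∫₀ᵗ (t - τ) 𝔄(τ) x dτ`. -/
def orbitInt (S : SystemNode X U Y) (x : X) (t : ℝ) : X :=
  ∫ τ in (0 : ℝ)..t, (t - τ) • S.semigroup.op τ.toNNReal x

theorem orbitInt_eq (x : X) {t : ℝ} :
    S.orbitInt x t = ∫ s in (0 : ℝ)..t, ∫ τ in (0 : ℝ)..s, S.semigroup.op τ.toNNReal x := by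
  have hc := S.semigroup.continuous_orbit x
  set f : ℝ → X := fun τ => S.semigroup.op τ.toNNReal x with hf
  have hV : ∀ s, HasDerivAt (fun s => ∫ τ in (0 : ℝ)..s, f τ) (f s) s := fun s =>
    (hc.integral_hasStrictDerivAt 0 s).hasDerivAt
  have hVc : Continuous fun s => ∫ τ in (0 : ℝ)..s, f τ :=
    continuous_iff_continuousAt.2 fun s => (hV s).continuousAt
  have hd : ∀ s, HasDerivAt (fun s => (s - t) • ∫ τ in (0 : ℝ)..s, f τ)
      ((s - t) • f s + (1 : ℝ) • ∫ τ in (0 : ℝ)..s, f τ) s := fun s =>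
    ((hasDerivAt_id s).sub_const t).smul (hV s)
  have hI := intervalIntegral.integral_eq_sub_of_hasDerivAt (a := 0) (b := t)
    (fun s _ => hd s) (Continuous.intervalIntegrable (by fun_prop) _ _)
  rw [intervalIntegral.integral_add (Continuous.intervalIntegrable (by fun_prop) _ _)
    (Continuous.intervalIntegrable (by fun_prop) _ _)] at hI
  simp only [one_smul, sub_self, zero_smul, intervalIntegral.integral_same, smul_zero] at hI
  rw [add_comm, add_eq_zero_iff_eq_neg, ← intervalIntegral.integral_neg] at hI
  rw [hI]
  unfold orbitInt
  refine intervalIntegral.integral_congr fun s _ => ?_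
  simp only [← neg_smul, neg_sub, hf]

/-- `(α I - A)` applied to the second integral of the orbit of `x`. -/
def orbitShift (x : X) (t : ℝ) : X :=
  (α.1 : ℂ) • (∫ s in (0 : ℝ)..t, ∫ τ in (0 : ℝ)..s, S.semigroup.op τ.toNNReal x) -
    (∫ s in (0 : ℝ)..t, S.semigroup.op s.toNNReal x) + t • x

theorem continuous_orbitShift (x : X) : Continuous (orbitShift α x) := by
  have hc := S.semigroup.continuous_orbit x
  have hV : Continuous fun s => ∫ τ in (0 : ℝ)..s, S.semigroup.op τ.toNNReal x :=
    intervalIntegral.continuous_primitive (fun _ _ => hc.intervalIntegrable _ _) 0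
  have hW : Continuous fun t => ∫ s in (0 : ℝ)..t, ∫ τ in (0 : ℝ)..s, S.semigroup.op τ.toNNReal x :=
    intervalIntegral.continuous_primitive (fun _ _ => hV.intervalIntegrable _ _) 0
  unfold orbitShift
  fun_prop

theorem orbitInt_eq_resolvent (x : X) {t : ℝ} (ht : 0 ≤ t) :
    S.orbitInt x t = resolvent α (orbitShift α x t) := by
  have hc := S.semigroup.continuous_orbit x
  have hV : Continuous fun s => ∫ τ in (0 : ℝ)..s, S.semigroup.op τ.toNNReal x :=
    intervalIntegral.continuous_primitive (fun _ _ => hc.intervalIntegrable _ _) 0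
  have h1 : (∫ s in (0 : ℝ)..t, ∫ τ in (0 : ℝ)..s, S.semigroup.op τ.toNNReal x) =
      ∫ s in (0 : ℝ)..t, resolvent α ((α.1 : ℂ) • (∫ τ in (0 : ℝ)..s, S.semigroup.op τ.toNNReal x) -
        (S.semigroup.op s.toNNReal x - x)) := by
    refine intervalIntegral.integral_congr fun s hs => ?_
    rw [uIcc_of_le ht] at hs
    exact ((mem_graph_iff_resolvent α).1 (S.isGenerator.integral_graph x hs.1)).symm
  rw [orbitInt_eq, h1, ContinuousLinearMap.intervalIntegral_comp_comm _
    (Continuous.intervalIntegrable (by fun_prop) _ _),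
    intervalIntegral.integral_sub (Continuous.intervalIntegrable (by fun_prop) _ _)
      (Continuous.intervalIntegrable (by fun_prop) _ _),
    intervalIntegral.integral_sub (Continuous.intervalIntegrable (by fun_prop) _ _)
      (Continuous.intervalIntegrable (by fun_prop) _ _), intervalIntegral.integral_smul]
  simp only [intervalIntegral.integral_const, sub_zero, orbitShift]
  rw [sub_add]

theorem orbitInt_mem (α : S.ResolventPoint) (x : X) {t : ℝ} (ht : 0 ≤ t) : S.orbitInt x t ∈ S.A.domain := by
  rw [orbitInt_eq_resolvent α x ht]
  exact resolvent_mem α _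

/-- `C (α I - A)⁻¹` is a bounded operator. -/
def CResolvent : X →L[ℂ] Y :=
  LinearMap.mkContinuousOfExistsBound (S.C ∘ₗ ((shiftEquiv α).symm : X →ₗ[ℂ] S.A.domain)) (by
    obtain ⟨K, hK⟩ := S.bounded_CD
    refine ⟨|K| * (‖resolvent α‖ + ‖(α.1 : ℂ) • resolvent α - ContinuousLinearMap.id ℂ X‖),
      fun x => ?_⟩
    have hA : S.A ((shiftEquiv α).symm x) =
        ((α.1 : ℂ) • resolvent α - ContinuousLinearMap.id ℂ X) x := by
      have h := shiftEquiv_apply α ((shiftEquiv α).symm x)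
      rw [LinearEquiv.apply_symm_apply, eq_sub_iff_add_eq, ← eq_sub_iff_add_eq'] at h
      exact h
    have h := hK ⟨((((shiftEquiv α).symm x : S.A.domain) : X), 0), ((shiftEquiv α).symm x).2⟩
    have h2 : ‖S.C ((shiftEquiv α).symm x)‖ ≤
        K * (‖resolvent α x‖ + ‖S.A ((shiftEquiv α).symm x)‖) := by
      have : ‖((resolvent α x, (0 : U)) : X × U)‖ = ‖resolvent α x‖ := by
        simp [Prod.norm_def]
      rw [← this]
      exact h
    refine h2.trans ?_
    rw [hA, mul_assoc]
    refine mul_le_mul (le_abs_self K) ?_ (by positivity) (abs_nonneg K)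
    rw [add_mul]
    exact add_le_add (ContinuousLinearMap.le_opNorm _ _) (ContinuousLinearMap.le_opNorm _ _))

theorem CResolvent_apply (x : X) : CResolvent α x = S.C ((shiftEquiv α).symm x) := rfl

/-- The function `t ↦ C ∫₀ᵗ (t - τ) 𝔄(τ) x dτ`, for `t ≥ 0`. -/
def freeOutputInt (x : X) (t : ℝ) : Y :=
  S.C ⟨S.orbitInt x t.toNNReal, orbitInt_mem α x t.toNNReal.2⟩

theorem freeOutputInt_eq (x : X) (t : ℝ) :
    freeOutputInt α x t = CResolvent α (orbitShift α x t.toNNReal) := by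
  rw [CResolvent_apply]
  unfold freeOutputInt
  congr 1
  exact Subtype.ext (orbitInt_eq_resolvent α x t.toNNReal.2)

theorem memLp_freeOutputInt (T : ℝ) (x : X) :
    MemLp (freeOutputInt α x) 2 (volume.restrict (Icc (0 : ℝ) T)) := by
  have hc : Continuous (freeOutputInt α x) := by
    rw [show freeOutputInt α x = fun t => CResolvent α (orbitShift α x t.toNNReal) from
      funext (freeOutputInt_eq α x)]
    exact (CResolvent α).continuous.comp ((continuous_orbitShift α x).comp
      (NNReal.continuous_coe.comp continuous_real_toNNReal))
  obtain ⟨K, hK⟩ := isCompact_Icc.exists_bound_of_continuousOn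
    (hc.continuousOn (s := Icc (0 : ℝ) T))
  refine MemLp.of_bound hc.aestronglyMeasurable K ?_
  filter_upwards [ae_restrict_mem measurableSet_Icc] with t ht using hK t ht

theorem orbitInt_add (x y : X) (t : ℝ) :
    S.orbitInt (x + y) t = S.orbitInt x t + S.orbitInt y t := by
  have hc := S.semigroup.continuous_orbit x
  have hc' := S.semigroup.continuous_orbit y
  unfold orbitInt
  rw [← intervalIntegral.integral_add (Continuous.intervalIntegrable (by fun_prop) _ _)
    (Continuous.intervalIntegrable (by fun_prop) _ _)]
  simp

theorem orbitInt_smul (c : ℂ) (x : X) (t : ℝ) : S.orbitInt (c • x) t = c • S.orbitInt x t := by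
  unfold orbitInt
  rw [← intervalIntegral.integral_smul]
  simp only [map_smul, smul_comm c]

/-- The linear map `x ↦ C ∫₀^· (· - τ) 𝔄(τ) x dτ` from `X` to `L²([0,T]; Y)`. -/
def freeOutputL2 (T : ℝ) : X →ₗ[ℂ] L2 T Y where
  toFun x := (memLp_freeOutputInt α T x).toLp
  map_add' x y := by
    rw [← MemLp.toLp_add]
    congr 1
    funext t
    rw [Pi.add_apply]
    unfold freeOutputInt
    rw [← map_add]
    exact congrArg S.C (Subtype.ext (orbitInt_add x y _))
  map_smul' c x := by
    rw [RingHom.id_apply, ← MemLp.toLp_const_smul]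
    congr 1
    funext t
    rw [Pi.smul_apply]
    unfold freeOutputInt
    rw [← map_smul]
    exact congrArg S.C (Subtype.ext (orbitInt_smul c x _))

/-- The state-to-output map `ℭ_T` as an operator from `X₋₁` to `H⁻²_{0l}([0,T]; Y)`. On `X` it
is `x ↦ (d²/dt²)_l C ∫₀^· (· - τ) 𝔄(τ) x dτ`; it is then extended by closure, whenever this is
possible. If the map on `X` is bounded for the norm of `X₋₁`, the result is its bounded
extension to all of `X₋₁`; if the map on `X` is not closable, the domain is `X`. -/
def stateOutput (T : ℝ) : Extrap α →ₗ.[ℂ] Hm20l T Y :=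
  LinearPMap.closure
    { domain := LinearMap.range (toExtrap α : X →ₗ[ℂ] Extrap α)
      toFun := (secondDeriv ∘ₗ freeOutputL2 α T) ∘ₗ
        ((LinearEquiv.ofInjective (toExtrap α : X →ₗ[ℂ] Extrap α) (toExtrap_injective α)).symm :
          LinearMap.range (toExtrap α : X →ₗ[ℂ] Extrap α) →ₗ[ℂ] X) }

theorem stateOutput_graph (T : ℝ) (x : X) :
    (toExtrap α x, secondDeriv (freeOutputL2 α T x)) ∈ (stateOutput α T).graph := by
  refine LinearPMap.le_graph_of_le (LinearPMap.le_closure _) ?_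
  refine (LinearPMap.mem_graph_iff _).2 ⟨⟨toExtrap α x, x, rfl⟩, rfl, ?_⟩
  change secondDeriv (freeOutputL2 α T ((LinearEquiv.ofInjective _ _).symm
    (LinearEquiv.ofInjective (toExtrap α : X →ₗ[ℂ] Extrap α) (toExtrap_injective α) x))) = _
  rw [LinearEquiv.symm_apply_apply]

/-- The input-to-state map: `𝔅_t u = ∫₀ᵗ 𝔄₋₁(t - τ) B u(τ) dτ ∈ X₋₁`. -/
def inputState {T : ℝ} (t : ℝ) (u : L2 T U) : Extrap α :=
  ∫ τ in (0 : ℝ)..t, extOp α (t - τ).toNNReal (control α (u τ))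

/-- The graph of the input-to-output map `𝔇_T : L²([0,T]; U) → H⁻²_{0l}([0,T]; Y)`,
`𝔇_T u = (d²/dt²)_l C&D ∫₀^· (· - τ) (𝔅_τ u, u(τ)) dτ`. Here `(z, ∫₀ᵗ (t - τ) u(τ) dτ)` is the
second integral at time `t`, whose first entry is computed in `X₋₁` and is an element of `X`. -/
def IsInputOutput {T : ℝ} (u : L2 T U) (η : Hm20l T Y) : Prop :=
  ∃ p : L2 T Y, η = secondDeriv p ∧ ∀ᵐ t ∂(volume.restrict (Icc (0 : ℝ) T)),
    ∃ (z : X) (h : (z, ∫ τ in (0 : ℝ)..t, (t - τ) • u τ) ∈ S.AB.domain),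
      toExtrap α z = ∫ τ in (0 : ℝ)..t, (t - τ) • inputState α τ u ∧ p t = S.CD ⟨_, h⟩

/-- `ℭ_T x₀ + 𝔇_T u` is defined and equal to the function `y ∈ L²([0,T]; Y)`. -/
def IsOutput {T : ℝ} (x₀ : Extrap α) (u : L2 T U) (y : L2 T Y) : Prop :=
  ∃ η ξ : Hm20l T Y, (x₀, η) ∈ (stateOutput α T).graph ∧ IsInputOutput α u ξ ∧
    η + ξ = embedL2 y

/-- The graph of the `F`-terminal value map `𝔗_{F,T}`, the closure with respect to `u` of
`(x₀, u) ↦ F (𝔄₋₁(T) x₀ + 𝔅_T u)`, defined where `𝔄₋₁(T) x₀ + 𝔅_T u ∈ X`. If that map is not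
closable with respect to `u`, this is the graph of a multi-valued map. -/
def IsTerminalValue {T : ℝ} (F : X →L[ℂ] Z) (x₀ : Extrap α) (u : L2 T U) (z : Z) : Prop :=
  ∃ (v : ℕ → L2 T U) (x : ℕ → X), Tendsto v atTop (𝓝 u) ∧
    (∀ n, toExtrap α (x n) = extOp α T.toNNReal x₀ + inputState α T (v n)) ∧
    Tendsto (fun n => F (x n)) atTop (𝓝 z)

/-- The graph of the `F`-input map `ℑ_{F,T} u = (𝔗_{F,T} (0, u), 𝔇_T u)`, with domain the
inputs for which `(0, u) ∈ dom 𝔗_{F,T}` and `𝔇_T u ∈ L²([0,T]; Y)`. -/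
def IsInputMapValue {T : ℝ} (F : X →L[ℂ] Z) (u : L2 T U) (z : Z) (y : L2 T Y) : Prop :=
  IsTerminalValue α F 0 u z ∧ IsInputOutput α u (embedL2 y)

/-- `ℑ_{F,T}` is injective: different inputs have no common value. -/
def InputMapInjective (T : ℝ) (F : X →L[ℂ] Z) : Prop :=
  ∀ (u v : L2 T U) (z : Z) (y : L2 T Y),
    IsInputMapValue α F u z y → IsInputMapValue α F v z y → u = v

/-- The set `𝓑_F` of all `w ∈ Z` with `B^* ∫₀^· (· - τ) 𝔄(τ)^* F^* w dτ ∈ H²_{0l}([0,T]; U)`. -/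
def adjointRegularSet (T : ℝ) (F : X →L[ℂ] Z) : Set Z :=
  {w | ∃ v : H20l T U, ∀ᵐ t ∂(volume.restrict (Icc (0 : ℝ) T)),
    ∃ h : (∫ τ in (0 : ℝ)..t, (t - τ) • ContinuousLinearMap.adjoint (S.semigroup.op τ.toNNReal)
        (ContinuousLinearMap.adjoint F w)) ∈ S.A.adjoint.domain,
      controlAdjoint α ⟨_, h⟩ = (v : PiLp 2 fun _ : Fin 3 => L2 T U) 0 t}

/-! ### Trajectories and the optimal control problem -/

/-- `(x, u, y)` is a classical trajectory on `[0, T]`. -/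
def IsClassicalTrajectory (S : SystemNode X U Y) (T : ℝ) (x : ℝ → X) (u : ℝ → U) (y : ℝ → Y) :
    Prop :=
  ContinuousOn u (Icc 0 T) ∧ ContinuousOn y (Icc 0 T) ∧
    ∃ x' : ℝ → X, ContinuousOn x' (Icc 0 T) ∧
      ∀ t ∈ Icc 0 T, HasDerivWithinAt x (x' t) (Icc 0 T) t ∧
        ∃ h : (x t, u t) ∈ S.AB.domain, x' t = S.AB ⟨_, h⟩ ∧ y t = S.CD ⟨_, h⟩

/-- `(x, u, y)` is a generalized trajectory on `[0, T]`: a limit of classical trajectories in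
`C([0,T]; X) × L²([0,T]; U) × L²([0,T]; Y)`. -/
def IsGeneralizedTrajectory (S : SystemNode X U Y) (T : ℝ) (x : ℝ → X) (u : L2 T U)
    (y : L2 T Y) : Prop :=
  ∃ (xn : ℕ → ℝ → X) (un : ℕ → ℝ → U) (yn : ℕ → ℝ → Y),
    (∀ n, S.IsClassicalTrajectory T (xn n) (un n) (yn n)) ∧
    TendstoUniformlyOn xn x atTop (Icc 0 T) ∧
    Tendsto (fun n => eLpNorm (fun t => un n t - u t) 2 (volume.restrict (Icc (0 : ℝ) T))) atTop (𝓝 0) ∧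
    Tendsto (fun n => eLpNorm (fun t => yn n t - y t) 2 (volume.restrict (Icc (0 : ℝ) T))) atTop (𝓝 0)

/-- Coercivity of the cost functional along the generalized trajectories that start in `0`. -/
def CoerciveOnTrajectories (S : SystemNode X U Y) (T : ℝ) (F : X →L[ℂ] Z) : Prop :=
  ∃ c > 0, ∀ (x : ℝ → X) (u : L2 T U) (y : L2 T Y), S.IsGeneralizedTrajectory T x u y →
    x 0 = 0 → c * ‖u‖ ^ 2 ≤ ‖y‖ ^ 2 + ‖F (x T)‖

/-- Coercivity of the cost functional on the domain of the `F`-input map. -/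
def CoerciveOnInputs (T : ℝ) (F : X →L[ℂ] Z) : Prop :=
  ∃ c > 0, ∀ (u : L2 T U) (z : Z) (y : L2 T Y), IsInputMapValue α F u z y →
    c * ‖u‖ ^ 2 ≤ ‖y‖ ^ 2 + ‖z‖ ^ 2

/-- The cost of an input: `½ ‖(𝔗_{F,T}(x₀, u) - z_f, ℭ_T x₀ + 𝔇_T u - y_ref)‖²` if
`(x₀, u) ∈ dom 𝔗_{F,T}` and `ℭ_T x₀ + 𝔇_T u ∈ L²([0,T]; Y)`, and `∞` otherwise. The infimum
runs over the values `z` of `𝔗_{F,T}(x₀, u)` and `y` of `ℭ_T x₀ + 𝔇_T u`; there is at most one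
`y`, and at most one `z` whenever the map of which `𝔗_{F,T}` is the closure is closable. -/
def cost {T : ℝ} (F : X →L[ℂ] Z) (x₀ : Extrap α) (zf : Z) (yref : L2 T Y) (u : L2 T U) :
    ℝ≥0∞ :=
  ⨅ (z : Z) (y : L2 T Y) (_ : IsTerminalValue α F x₀ u z) (_ : IsOutput α x₀ u y),
    ENNReal.ofReal ((‖z - zf‖ ^ 2 + ‖y - yref‖ ^ 2) / 2)

/-- `u` is an optimal control. -/
def IsOptimalControl {T : ℝ} (F : X →L[ℂ] Z) (x₀ : Extrap α) (zf : Z) (yref : L2 T Y)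
    (Uad : Set (L2 T U)) (u : L2 T U) : Prop :=
  u ∈ Uad ∧ cost α F x₀ zf yref u = ⨅ v ∈ Uad, cost α F x₀ zf yref v

end SystemNode

end OptControl

end

noncomputable section

namespace OptControl

/-! ### Hilbert space geometry -/

section Hilbert

variable {H : Type*} [NormedAddCommGroup H] [InnerProductSpace ℂ H]

/-! The control problem is a least-distance problem. Let `admissible` be the set of triples (u, (z,
y)) with u ∈ 𝓤_ad, z a terminal value and y the output. The cost of u is half the squared distance
from (z, y) to (z_f, y_ref), minimised over z. The set is midpoint-convex, and it is closed: the
terminal value relation is a closure by definition, and the output equation reads η + (outputOp u)''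
= y in H⁻² with continuous terms (`isInputOutput_iff`, `isClosed_admissible`).

Existence. The projection of this set to (z, y) need not be closed, but bounds on (z, y) bound u:
either 𝓤_ad is bounded, or coercivity applies to the difference from a fixed admissible triple. The
near-minimisers thus form decreasing bounded closed midpoint-convex sets in a Hilbert space, and
these have a common point (`exists_mem_iInter_of_midpoint`, `exists_min_norm_snd_sub`).

Uniqueness. By the parallelogram law two minimisers share (z, y). The difference of their inputs
then has (0, 0) as a value of the F-input map, as the input 0 does, so injectivity identifies the
inputs (`existsUnique_isOptimalControl`).

Coercivity along trajectories implies coercivity on inputs. With V the Volterra operator, the input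
V²f drives a classical trajectory from 0 with output `outputOp f`. Replacing f by l f with l → ∞
removes the terminal term, which grows only linearly, and leaves c‖V²f‖² ≤ ‖outputOp f‖²
(`norm_sq_volterra_le`). If 𝔇_T u = y ∈ L², then `outputOp u` = V²y, so c‖V²u‖² ≤ ‖V²y‖². To strip
V², note that the pairs (u, y) form a closed V-invariant subspace; V is injective and accretive
there, hence has dense range in it (`le_closure_map_of_accretive`).

All of this rests on writing X₋₁ in resolvent coordinates, where B becomes bounded and the twice
integrated input-output map is a bounded operator commuting with V. -/

theorem norm_sub_sq_eq_midpoint (x y : H) :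
    ‖x - y‖ ^ 2 = 2 * ‖x‖ ^ 2 + 2 * ‖y‖ ^ 2 - 4 * ‖(2⁻¹ : ℂ) • (x + y)‖ ^ 2 := by
  have h := parallelogram_law_with_norm ℂ x y
  rw [norm_smul, mul_pow]
  norm_num
  linarith

/-- A decreasing sequence of nonempty closed bounded midpoint-convex subsets of a Hilbert space
has a common point. -/
theorem exists_mem_iInter_of_midpoint [CompleteSpace H] (K : ℕ → Set H) (hK : Antitone K)
    (hne : ∀ n, (K n).Nonempty) (hcl : ∀ n, IsClosed (K n))
    (hmid : ∀ n, ∀ x ∈ K n, ∀ y ∈ K n, (2⁻¹ : ℂ) • (x + y) ∈ K n)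
    (hbd : Bornology.IsBounded (K 0)) : ∃ x, ∀ n, x ∈ K n := by
  obtain ⟨R, hR⟩ := hbd.exists_norm_le
  -- The infima of the squared norm increase as the sets shrink and stay below R², hence converge.
  -- Near-minimal points then take the place of a weak compactness argument.
  set m : ℕ → ℝ := fun n => sInf ((fun x => ‖x‖ ^ 2) '' K n) with hm
  have hbelow : ∀ n, BddBelow ((fun x : H => ‖x‖ ^ 2) '' K n) := fun n =>
    ⟨0, by rintro _ ⟨x, -, rfl⟩; positivity⟩
  have hle : ∀ n, ∀ x ∈ K n, m n ≤ ‖x‖ ^ 2 := fun n x hx => csInf_le (hbelow n) ⟨x, hx, rfl⟩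
  have hmono : Monotone m := fun i j hij =>
    csInf_le_csInf (hbelow i) ((hne j).image _) (image_mono (hK hij))
  have hbdd : BddAbove (range m) := by
    refine ⟨R ^ 2, ?_⟩
    rintro _ ⟨n, rfl⟩
    obtain ⟨x, hx⟩ := hne n
    exact (hle n x hx).trans (pow_le_pow_left₀ (norm_nonneg _) (hR x (hK (Nat.zero_le n) hx)) 2)
  have hlim := tendsto_atTop_ciSup hmono hbdd
  set M := ⨆ n, m n
  have hmM : ∀ n, m n ≤ M := fun n => le_ciSup hbdd n
  have hex : ∀ n, ∃ x ∈ K n, ‖x‖ ^ 2 < m n + 1 / ((n : ℝ) + 1) := by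
    intro n
    obtain ⟨_, ⟨x, hx, rfl⟩, h⟩ := exists_lt_of_csInf_lt ((hne n).image (fun x : H => ‖x‖ ^ 2))
      (show m n < m n + 1 / ((n : ℝ) + 1) from lt_add_of_pos_right _ (by positivity))
    exact ⟨x, hx, h⟩
  choose x hxK hx using hex
  -- The midpoint of two late points lies in `K n`, so its squared norm is at least `m n`. The
  -- parallelogram law then bounds the distance by 2·2(M + 1/(n+1)) − 4 m n.
  have hdist : ∀ n i j, n ≤ i → n ≤ j →
      ‖x i - x j‖ ^ 2 ≤ 4 * (M - m n + 1 / ((n : ℝ) + 1)) := by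
    intro n i j hi hj
    have h1 := hle n _ (hmid n _ (hK hi (hxK i)) _ (hK hj (hxK j)))
    have h2 : ∀ i, n ≤ i → ‖x i‖ ^ 2 ≤ M + 1 / ((n : ℝ) + 1) := fun i hi => by
      have : 1 / ((i : ℝ) + 1) ≤ 1 / ((n : ℝ) + 1) := by gcongr
      linarith [hx i, hmM i]
    rw [norm_sub_sq_eq_midpoint]
    linarith [h2 i hi, h2 j hj]
  have hb : Tendsto (fun n : ℕ => 4 * (M - m n + 1 / ((n : ℝ) + 1))) atTop (𝓝 0) := by
    have := ((tendsto_const_nhds (x := M)).sub hlim).add tendsto_one_div_add_atTop_nhds_zero_nat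
    simpa using this.const_mul 4
  have hcauchy : CauchySeq x := by
    refine cauchySeq_of_le_tendsto_0 (fun n => √(4 * (M - m n + 1 / ((n : ℝ) + 1)))) ?_ ?_
    · intro i j n hi hj
      rw [dist_eq_norm]
      exact Real.le_sqrt_of_sq_le (hdist n i j hi hj)
    · have := (Real.continuous_sqrt.tendsto 0).comp hb
      rwa [Real.sqrt_zero] at this
  obtain ⟨y, hy⟩ := cauchySeq_tendsto_of_complete hcauchy
  refine ⟨y, fun n => (hcl n).mem_of_tendsto hy ?_⟩
  filter_upwards [eventually_ge_atTop n] with i hi using hK hi (hxK i)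

/-- A closed midpoint-convex set on which the first component is controlled by the second
contains a point whose second component is closest to a given target. -/
theorem exists_min_norm_snd_sub {E : Type*} [NormedAddCommGroup E] [InnerProductSpace ℂ E]
    [CompleteSpace H] [CompleteSpace E] (K : Set (H × E)) (hne : K.Nonempty) (hcl : IsClosed K)
    (hmid : ∀ p ∈ K, ∀ q ∈ K, (2⁻¹ : ℂ) • (p + q) ∈ K)
    (hbd : ∀ r : ℝ, ∃ R : ℝ, ∀ p ∈ K, ‖p.2‖ ≤ r → ‖p.1‖ ≤ R) (e : E) :
    ∃ p ∈ K, ∀ q ∈ K, ‖p.2 - e‖ ≤ ‖q.2 - e‖ := by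
  set d : ℝ := sInf ((fun p : H × E => ‖p.2 - e‖) '' K)
  have hbelow : BddBelow ((fun p : H × E => ‖p.2 - e‖) '' K) :=
    ⟨0, by rintro _ ⟨x, -, rfl⟩; positivity⟩
  -- Near-minimisers, viewed in the Hilbert sum so that the parallelogram law is available for
  -- pairs.
  set L : ℕ → Set (WithLp 2 (H × E)) := fun n =>
    {p | (p.fst, p.snd) ∈ K ∧ ‖p.snd - e‖ ≤ d + 1 / ((n : ℝ) + 1)} with hL
  have key : ∃ p, ∀ n, p ∈ L n := by
    refine exists_mem_iInter_of_midpoint L ?_ ?_ ?_ ?_ ?_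
    · intro i j hij p hp
      refine ⟨hp.1, hp.2.trans ?_⟩
      gcongr
    · intro n
      obtain ⟨_, ⟨p, hp, rfl⟩, h⟩ := exists_lt_of_csInf_lt (hne.image (fun p : H × E => ‖p.2 - e‖))
        (show d < d + 1 / ((n : ℝ) + 1) from lt_add_of_pos_right _ (by positivity))
      exact ⟨WithLp.toLp 2 p, hp, h.le⟩
    · intro n
      exact (hcl.preimage (f := fun p : WithLp 2 (H × E) => (p.fst, p.snd)) (by fun_prop)).inter
        (isClosed_le (f := fun p : WithLp 2 (H × E) => ‖p.snd - e‖) (by fun_prop) continuous_const)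
    · rintro n x ⟨hx, hx'⟩ y ⟨hy, hy'⟩
      refine ⟨hmid _ hx _ hy, ?_⟩
      have : ((2⁻¹ : ℂ) • (x + y)).snd - e = (2⁻¹ : ℂ) • ((x.snd - e) + (y.snd - e)) := by
        simp only [WithLp.smul_snd, WithLp.add_snd]
        module
      rw [this, norm_smul]
      have := norm_add_le (x.snd - e) (y.snd - e)
      rw [show ‖(2⁻¹ : ℂ)‖ = 2⁻¹ by norm_num]
      linarith
    · obtain ⟨R, hR⟩ := hbd (d + 1 + ‖e‖)
      refine isBounded_iff_forall_norm_le.2 ⟨R + (d + 1 + ‖e‖), fun p hp => ?_⟩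
      have h1 : ‖p.snd‖ ≤ d + 1 + ‖e‖ := by
        have := norm_sub_norm_le p.snd e
        have := hp.2
        norm_num at this
        linarith
      have h2 := hR _ hp.1 h1
      refine le_trans ?_ (add_le_add h2 h1)
      have : p = WithLp.toLp 2 (p.fst, 0) + WithLp.toLp 2 (0, p.snd) := by
        apply (WithLp.equiv 2 (H × E)).injective
        simp [← WithLp.toLp_add, WithLp.equiv]
        rfl
      calc ‖p‖ ≤ ‖WithLp.toLp 2 (p.fst, (0 : E))‖ + ‖WithLp.toLp 2 ((0 : H), p.snd)‖ := by
            conv_lhs => rw [this]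
            exact norm_add_le _ _
        _ = _ := by simp
  obtain ⟨p, hp⟩ := key
  refine ⟨_, (hp 0).1, fun q hq => ?_⟩
  have h1 : d ≤ ‖q.2 - e‖ := csInf_le hbelow ⟨q, hq, rfl⟩
  refine le_trans ?_ h1
  have h2 : Tendsto (fun n : ℕ => d + 1 / ((n : ℝ) + 1)) atTop (𝓝 d) := by
    simpa using tendsto_one_div_add_atTop_nhds_zero_nat.const_add d
  exact ge_of_tendsto' h2 fun n => (hp n).2

/-- An injective accretive operator has dense range on every closed invariant subspace. -/
theorem le_closure_map_of_accretive [CompleteSpace H] (N : Submodule ℂ H)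
    (hN : IsClosed (N : Set H)) (L : H →L[ℂ] H) (hacc : ∀ x, 0 ≤ (inner ℂ (L x) x).re)
    (hinj : Function.Injective L) (hmap : ∀ x ∈ N, L x ∈ N) :
    N ≤ (N.map (L : H →ₗ[ℂ] H)).topologicalClosure := by
  set M := (N.map (L : H →ₗ[ℂ] H)).topologicalClosure
  have hMN : M ≤ N := Submodule.topologicalClosure_minimal _
    (by rintro _ ⟨x, hx, rfl⟩; exact hmap x hx) hN
  have : CompleteSpace M := (Submodule.isClosed_topologicalClosure _).completeSpace_coe
  intro x hx
  obtain ⟨y, hy, z, hz, rfl⟩ := M.exists_add_mem_mem_orthogonal x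
  have hzN : z ∈ N := by simpa using N.sub_mem hx (hMN hy)
  have hort : ∀ w ∈ N, inner ℂ (L w) z = 0 := fun w hw =>
    hz _ (Submodule.le_topologicalClosure _ ⟨w, hw, rfl⟩)
  -- Accretivity at z + s L z: both inner products against z vanish, because z is orthogonal to the
  -- image of N and both z and L z lie in N.
  have hq : ∀ s : ℝ, 0 ≤ s * (‖L z‖ ^ 2 + s * (inner ℂ (L (L z)) (L z)).re) := by
    intro s
    have h := hacc (z + (s : ℂ) • L z)
    simp only [map_add, map_smul, inner_add_left, inner_add_right, inner_smul_left,
      inner_smul_right, hort z hzN, hort _ (hmap z hzN), Complex.conj_ofReal,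
      inner_self_eq_norm_sq_to_K] at h
    simp only [mul_zero, zero_add, Complex.add_re, Complex.re_ofReal_mul] at h
    rw [show ((RCLike.ofReal ‖L z‖ : ℂ) ^ 2) = ((‖L z‖ ^ 2 : ℝ) : ℂ) by push_cast; rfl,
      Complex.ofReal_re] at h
    linarith
  have h0 : ‖L z‖ ^ 2 ≤ 0 := by
    have hlim : Tendsto (fun s : ℝ => ‖L z‖ ^ 2 + s * (inner ℂ (L (L z)) (L z)).re) (𝓝[<] 0)
        (𝓝 (‖L z‖ ^ 2)) := by
      have : Continuous fun s : ℝ => ‖L z‖ ^ 2 + s * (inner ℂ (L (L z)) (L z)).re := by fun_prop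
      simpa using (this.tendsto 0).mono_left nhdsWithin_le_nhds
    -- For s < 0 the other factor must be nonpositive; letting s ↑ 0 leaves ‖L z‖² ≤ 0.
    refine le_of_tendsto hlim ?_
    filter_upwards [self_mem_nhdsWithin] with s hs
    exact nonpos_of_mul_nonneg_right (hq s) hs
  have hLz : L z = 0 := by
    rw [← norm_eq_zero]
    exact pow_eq_zero_iff two_ne_zero |>.1 (le_antisymm h0 (sq_nonneg _))
  rw [hinj (hLz.trans (map_zero L).symm), add_zero]
  exact hy

end Hilbert

/-! ### Integrals over triangles -/

theorem integral_indicator_triangle {E : Type*} [NormedAddCommGroup E] [NormedSpace ℝ E]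
    (h : ℝ → ℝ → E) {t r : ℝ} (hr : r ∈ Ioc 0 t) :
    ∫ s in Ioc 0 t, {p : ℝ × ℝ | p.2 ≤ p.1}.indicator (Function.uncurry h) (s, r) =
      ∫ s in r..t, h s r := by
  have : (fun s => {p : ℝ × ℝ | p.2 ≤ p.1}.indicator (Function.uncurry h) (s, r)) =
      (Ici r).indicator (fun s => h s r) := by
    ext s
    simp [indicator]
  simp only [this]
  rw [integral_indicator measurableSet_Ici, Measure.restrict_restrict measurableSet_Ici,
    intervalIntegral.integral_of_le hr.2, ← integral_Icc_eq_integral_Ioc]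
  congr 2
  ext s
  simp only [mem_Ioc, mem_inter_iff, mem_Icc, mem_Ici] at hr ⊢
  grind

theorem integral_triangle_swap {E : Type*} [NormedAddCommGroup E] [NormedSpace ℝ E]
    {h : ℝ → ℝ → E} {t : ℝ} (ht : 0 ≤ t)
    (hh : Integrable (Function.uncurry h)
      ((volume.restrict (Ioc 0 t)).prod (volume.restrict (Ioc 0 t)))) :
    ∫ s in (0 : ℝ)..t, ∫ r in (0 : ℝ)..s, h s r = ∫ r in (0 : ℝ)..t, ∫ s in r..t, h s r := by
  have hk := hh.indicator (s := {p : ℝ × ℝ | p.2 ≤ p.1})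
    (measurableSet_le measurable_snd measurable_fst)
  have hsw := integral_integral_swap
    (f := fun s r => {p : ℝ × ℝ | p.2 ≤ p.1}.indicator (Function.uncurry h) (s, r)) hk
  rw [intervalIntegral.integral_of_le ht, intervalIntegral.integral_of_le ht]
  convert hsw using 1
  · refine setIntegral_congr_fun measurableSet_Ioc fun s hs => ?_
    have : (fun r => {p : ℝ × ℝ | p.2 ≤ p.1}.indicator (Function.uncurry h) (s, r)) =
        (Iic s).indicator (h s) := by
      ext r
      simp [indicator]
    simp only [this]
    rw [integral_indicator measurableSet_Iic, Measure.restrict_restrict measurableSet_Iic,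
      intervalIntegral.integral_of_le hs.1.le]
    congr 2
    ext r
    simp only [mem_Ioc, mem_inter_iff, mem_Iic]
    grind
  · exact setIntegral_congr_fun measurableSet_Ioc fun r hr =>
      (integral_indicator_triangle h hr).symm

theorem intervalIntegrable_integral_triangle {E : Type*} [NormedAddCommGroup E] [NormedSpace ℝ E]
    {h : ℝ → ℝ → E} {t : ℝ} (ht : 0 ≤ t)
    (hh : Integrable (Function.uncurry h)
      ((volume.restrict (Ioc 0 t)).prod (volume.restrict (Ioc 0 t)))) :
    IntervalIntegrable (fun r => ∫ s in r..t, h s r) volume 0 t := by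
  have hk := (hh.indicator (s := {p : ℝ × ℝ | p.2 ≤ p.1})
    (measurableSet_le measurable_snd measurable_fst)).integral_prod_right
  rw [intervalIntegrable_iff_integrableOn_Ioc_of_le ht]
  refine hk.congr ?_
  filter_upwards [ae_restrict_mem measurableSet_Ioc] with r hr
  exact integral_indicator_triangle h hr

/-! ### Convolution with strongly continuous operator families -/

section Conv

variable {E E' : Type*} [NormedAddCommGroup E] [NormedSpace ℂ E] [NormedAddCommGroup E']
  [NormedSpace ℂ E']

/-- The causal convolution `t ↦ ∫₀ᵗ Q(t - s) f(s) ds`. -/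
def causalConv (Q : ℝ → E →L[ℂ] E') (f : ℝ → E) (t : ℝ) : E' := ∫ s in (0 : ℝ)..t, Q (t - s) (f s)

variable {Q : ℝ → E →L[ℂ] E'} {f : ℝ → E} {T : ℝ}

theorem norm_causalConv_le {M : ℝ} (hM : ∀ t ∈ Icc 0 T, ‖Q t‖ ≤ M)
    (hf : IntegrableOn f (Icc 0 T)) {t : ℝ} (ht : t ∈ Icc 0 T) :
    ‖causalConv Q f t‖ ≤ M * ∫ s in Icc 0 T, ‖f s‖ := by
  have hM0 : 0 ≤ M := (norm_nonneg _).trans (hM t ht)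
  have hsub : Ioc 0 t ⊆ Icc 0 T := fun s hs => ⟨hs.1.le, hs.2.trans ht.2⟩
  rw [causalConv, intervalIntegral.integral_of_le ht.1, ← integral_const_mul]
  refine (norm_integral_le_of_norm_le ((hf.mono_set hsub).norm.const_mul M) ?_).trans
    (setIntegral_mono_set (hf.norm.const_mul M) ?_ (LE.le.eventuallyLE hsub))
  · filter_upwards [ae_restrict_mem measurableSet_Ioc] with s hs
    exact (Q _).le_of_opNorm_le (hM _ ⟨by linarith [hs.2], by linarith [hs.1, ht.2]⟩) _
  · exact .of_forall fun s => by positivity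

theorem exists_norm_le_of_strongly_continuous [CompleteSpace E]
    (hQ : ∀ x, Continuous fun t => Q t x) (a b : ℝ) :
    ∃ M, 0 ≤ M ∧ ∀ t ∈ Icc a b, ‖Q t‖ ≤ M := by
  obtain ⟨M, hM⟩ := banach_steinhaus (g := fun t : Icc a b => Q t) fun x => by
    obtain ⟨C, hC⟩ := isCompact_Icc.exists_bound_of_continuousOn ((hQ x).continuousOn (s := Icc a b))
    exact ⟨C, fun t => hC t t.2⟩
  exact ⟨max M 0, le_max_right _ _, fun t ht => (hM ⟨t, ht⟩).trans (le_max_left _ _)⟩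

/-- Banach–Steinhaus gives a bound locally uniform in time, which upgrades strong to joint
continuity. This is what makes s ↦ Q(t - s) f(s) measurable for a merely measurable f. -/
theorem continuous_uncurry_of_strongly_continuous [CompleteSpace E]
    (hQ : ∀ x, Continuous fun t => Q t x) : Continuous (Function.uncurry fun t x => Q t x) := by
  refine continuous_iff_continuousAt.2 fun ⟨t₀, x₀⟩ => ?_
  obtain ⟨M, -, hM⟩ := exists_norm_le_of_strongly_continuous hQ (t₀ - 1) (t₀ + 1)
  have h1 : Tendsto (fun p : ℝ × E => Q p.1 (p.2 - x₀)) (𝓝 (t₀, x₀)) (𝓝 0) := by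
    have h2 : Tendsto (fun p : ℝ × E => M * ‖p.2 - x₀‖) (𝓝 (t₀, x₀)) (𝓝 0) := by
      have : Continuous fun p : ℝ × E => M * ‖p.2 - x₀‖ := by fun_prop
      simpa using this.tendsto (t₀, x₀)
    refine squeeze_zero_norm' ?_ h2
    have h3 : ∀ᶠ p : ℝ × E in 𝓝 (t₀, x₀), p.1 ∈ Icc (t₀ - 1) (t₀ + 1) :=
      continuous_fst.continuousAt.eventually_mem (Icc_mem_nhds (by simp) (by simp))
    filter_upwards [h3] with p hp using (Q p.1).le_of_opNorm_le (hM _ hp) _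
  have h4 : Tendsto (fun p : ℝ × E => Q p.1 x₀) (𝓝 (t₀, x₀)) (𝓝 (Q t₀ x₀)) :=
    ((hQ x₀).comp continuous_fst).tendsto (t₀, x₀)
  have h5 := h1.add h4
  rw [zero_add] at h5
  refine h5.congr fun p => ?_
  rw [map_sub, sub_add_cancel]
  rfl

variable [CompleteSpace E]

theorem integrable_kernel_prod (hQ : ∀ x, Continuous fun t => Q t x) {a b : ℝ}
    (hf : IntegrableOn f (Ioc a b)) :
    Integrable (Function.uncurry fun r s => Q (r - s) (f s))
      ((volume.restrict (Ioc a b)).prod (volume.restrict (Ioc a b))) := by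
  obtain ⟨M, -, hM⟩ := exists_norm_le_of_strongly_continuous hQ (a - b) (b - a)
  have h1 : Integrable (fun p : ℝ × ℝ => f p.2)
      ((volume.restrict (Ioc a b)).prod (volume.restrict (Ioc a b))) := hf.comp_snd _
  refine (h1.norm.const_mul M).mono' ?_ ?_
  · exact (continuous_uncurry_of_strongly_continuous hQ).comp_aestronglyMeasurable₂
      (f := fun p : ℝ × ℝ => p.1 - p.2) (by fun_prop) h1.aestronglyMeasurable
  · rw [Measure.prod_restrict]
    filter_upwards [ae_restrict_mem (measurableSet_Ioc.prod measurableSet_Ioc)] with p hp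
    exact (Q _).le_of_opNorm_le (hM _ (by
      have h1 := hp.1; have h2 := hp.2
      simp only [mem_Ioc] at h1 h2
      constructor <;> linarith)) _

theorem integrableOn_kernel (hQ : ∀ x, Continuous fun t => Q t x) {a b : ℝ} (t : ℝ)
    (hf : IntegrableOn f (Icc a b)) : IntegrableOn (fun s => Q (t - s) (f s)) (Icc a b) := by
  obtain ⟨M, -, hM⟩ := exists_norm_le_of_strongly_continuous hQ (t - b) (t - a)
  refine (hf.norm.const_mul M).mono' ?_ ?_
  · exact (continuous_uncurry_of_strongly_continuous hQ).comp_aestronglyMeasurable₂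
      (f := fun s : ℝ => t - s) (by fun_prop) hf.aestronglyMeasurable
  · filter_upwards [ae_restrict_mem measurableSet_Icc] with s hs
    exact (Q _).le_of_opNorm_le (hM _ (by
      simp only [mem_Icc] at hs ⊢
      constructor <;> linarith)) _

theorem intervalIntegrable_kernel (hQ : ∀ x, Continuous fun t => Q t x) {a b : ℝ} (t : ℝ)
    (hf : IntegrableOn f (Icc 0 T)) (ha : a ∈ Icc 0 T) (hb : b ∈ Icc 0 T) :
    IntervalIntegrable (fun s => Q (t - s) (f s)) volume a b :=
  ((integrableOn_kernel hQ t hf).mono_set (uIcc_subset_Icc ha hb)).intervalIntegrable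

/-- On the fixed interval (0, T], with the indicator of s < t in the integrand, dominated
convergence applies: for every s ≠ t₀ the integrand is continuous in t at t₀. -/
theorem continuousOn_causalConv (hQ : ∀ x, Continuous fun t => Q t x)
    (hf : IntegrableOn f (Icc 0 T)) : ContinuousOn (causalConv Q f) (Icc 0 T) := by
  obtain ⟨M, -, hM⟩ := exists_norm_le_of_strongly_continuous hQ 0 T
  have heq : ∀ t ∈ Icc 0 T, causalConv Q f t =
      ∫ s in Ioc 0 T, (Iio t).indicator (fun s => Q (t - s) (f s)) s := by
    intro t ht
    rw [integral_indicator measurableSet_Iio, Measure.restrict_restrict measurableSet_Iio,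
      causalConv, intervalIntegral.integral_of_le ht.1, integral_Ioc_eq_integral_Ioo]
    congr 2
    ext s
    simp only [mem_Ioo, mem_inter_iff, mem_Iio, mem_Ioc, mem_Icc] at ht ⊢
    grind
  refine ContinuousOn.congr (fun t₀ ht₀ => ?_) heq
  refine continuousWithinAt_of_dominated (bound := fun s => M * ‖f s‖) ?_ ?_ ?_ ?_
  · exact .of_forall fun t => ((integrableOn_kernel hQ t hf).mono_set
      Ioc_subset_Icc_self).aestronglyMeasurable.indicator measurableSet_Iio
  · filter_upwards [self_mem_nhdsWithin] with t ht
    filter_upwards [ae_restrict_mem measurableSet_Ioc] with s hs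
    by_cases hst : s < t
    · rw [indicator_of_mem (by exact hst)]
      exact (Q _).le_of_opNorm_le (hM _ ⟨by linarith, by linarith [ht.2, hs.1]⟩) _
    · rw [indicator_of_notMem (by exact hst), norm_zero]
      -- The bound at time T serves only to show M ‖f s‖ ≥ 0.
      exact (norm_nonneg _).trans ((Q T).le_of_opNorm_le (hM _ ⟨ht.1.trans ht.2, le_rfl⟩) (f s))
  · exact (hf.mono_set Ioc_subset_Icc_self).norm.const_mul M
  · have : ∀ᵐ s ∂(volume.restrict (Ioc 0 T)), s ≠ t₀ := ae_restrict_of_ae (by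
      simp [ae_iff, measure_singleton])
    filter_upwards [this] with s hs
    refine ContinuousAt.continuousWithinAt ?_
    rcases lt_or_gt_of_ne hs with h | h
    · have : Continuous fun t => Q (t - s) (f s) := (hQ (f s)).comp (continuous_sub_right s)
      refine this.continuousAt.congr ?_
      filter_upwards [lt_mem_nhds h] with t ht
      rw [indicator_of_mem (by exact ht)]
    · refine (continuousAt_const (y := (0 : E'))).congr ?_
      filter_upwards [gt_mem_nhds h] with t ht
      rw [indicator_of_notMem (by simpa using ht.le)]

/-- Fubini on the triangle. The same double integral appears in `causalConv_integral`, so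
integrating before and after the convolution agree (`volterra_convOp`). -/
theorem integral_causalConv (hQ : ∀ x, Continuous fun t => Q t x)
    (hf : IntegrableOn f (Icc 0 T)) {t : ℝ} (ht : t ∈ Icc 0 T) :
    ∫ r in (0 : ℝ)..t, causalConv Q f r =
      ∫ s in (0 : ℝ)..t, ∫ r in (0 : ℝ)..(t - s), Q r (f s) := by
  have hsub : Ioc 0 t ⊆ Icc 0 T := fun s hs => ⟨hs.1.le, hs.2.trans ht.2⟩
  unfold causalConv
  rw [integral_triangle_swap ht.1 (integrable_kernel_prod hQ (hf.mono_set hsub))]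
  refine intervalIntegral.integral_congr fun s _ => ?_
  rw [intervalIntegral.integral_comp_sub_right (fun r => Q r (f s)), sub_self]

theorem intervalIntegrable_integral_kernel (hQ : ∀ x, Continuous fun t => Q t x)
    (hf : IntegrableOn f (Icc 0 T)) {t : ℝ} (ht : t ∈ Icc 0 T) :
    IntervalIntegrable (fun s => ∫ r in (0 : ℝ)..(t - s), Q r (f s)) volume 0 t := by
  have hsub : Ioc 0 t ⊆ Icc 0 T := fun s hs => ⟨hs.1.le, hs.2.trans ht.2⟩
  refine (intervalIntegrable_integral_triangle ht.1
    (integrable_kernel_prod hQ (hf.mono_set hsub))).congr fun s _ => ?_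
  rw [intervalIntegral.integral_comp_sub_right (fun r => Q r (f s)), sub_self]

theorem causalConv_integral [CompleteSpace E'] (hQ : ∀ x, Continuous fun t => Q t x)
    (hf : IntegrableOn f (Icc 0 T)) {t : ℝ} (ht : t ∈ Icc 0 T) :
    causalConv Q (fun s => ∫ r in (0 : ℝ)..s, f r) t =
      ∫ s in (0 : ℝ)..t, ∫ r in (0 : ℝ)..(t - s), Q r (f s) := by
  have hsub : Ioc 0 t ⊆ Icc 0 T := fun s hs => ⟨hs.1.le, hs.2.trans ht.2⟩
  have hi : Integrable (Function.uncurry fun s r => Q (t - s) (f r))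
      ((volume.restrict (Ioc 0 t)).prod (volume.restrict (Ioc 0 t))) := by
    obtain ⟨M, -, hM⟩ := exists_norm_le_of_strongly_continuous hQ 0 t
    have h1 : Integrable (fun p : ℝ × ℝ => f p.2)
        ((volume.restrict (Ioc 0 t)).prod (volume.restrict (Ioc 0 t))) :=
      (hf.mono_set hsub).integrable.comp_snd _
    refine (h1.norm.const_mul M).mono' ?_ ?_
    · exact (continuous_uncurry_of_strongly_continuous hQ).comp_aestronglyMeasurable₂
        (f := fun p : ℝ × ℝ => t - p.1) (by fun_prop) h1.aestronglyMeasurable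
    · rw [Measure.prod_restrict]
      filter_upwards [ae_restrict_mem (measurableSet_Ioc.prod measurableSet_Ioc)] with p hp
      exact (Q _).le_of_opNorm_le (hM _ ⟨by linarith [hp.1.2], by linarith [hp.1.1]⟩) _
  have h1 : causalConv Q (fun s => ∫ r in (0 : ℝ)..s, f r) t =
      ∫ s in (0 : ℝ)..t, ∫ r in (0 : ℝ)..s, Q (t - s) (f r) := by
    refine intervalIntegral.integral_congr fun s hs => ?_
    rw [uIcc_of_le ht.1] at hs
    refine (ContinuousLinearMap.intervalIntegral_comp_comm _ ?_).symm
    exact (hf.mono_set (uIcc_subset_Icc ⟨le_rfl, ht.1.trans ht.2⟩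
      ⟨hs.1, hs.2.trans ht.2⟩)).intervalIntegrable
  rw [h1, integral_triangle_swap ht.1 hi]
  refine intervalIntegral.integral_congr fun s _ => ?_
  rw [intervalIntegral.integral_comp_sub_left (fun r => Q r (f s)), sub_self]

end Conv

/-! ### Operators on `L²([0,T]; E)` -/

section L2Operators

theorem L2.integrableOn {E : Type*} [NormedAddCommGroup E] {T : ℝ} (f : L2 T E) :
    IntegrableOn f (Icc 0 T) :=
  (Lp.memLp f).integrable (by norm_num)

theorem memLp_of_continuousOn {E : Type*} [NormedAddCommGroup E] {T : ℝ} {g : ℝ → E}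
    (hg : ContinuousOn g (Icc 0 T)) :
    MemLp g 2 (volume.restrict (Icc (0 : ℝ) T)) := by
  obtain ⟨K, hK⟩ := isCompact_Icc.exists_bound_of_continuousOn hg
  refine MemLp.of_bound (hg.aestronglyMeasurable measurableSet_Icc) K ?_
  filter_upwards [ae_restrict_mem measurableSet_Icc] with t ht using hK t ht

variable {E E' : Type*} [NormedAddCommGroup E] [InnerProductSpace ℂ E]
  [NormedAddCommGroup E'] [InnerProductSpace ℂ E'] {T : ℝ}

/-- The L¹–L² inequality on a finite measure space; the constant is the total mass to the power 1 −
1/2. -/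
theorem L2.integral_norm_le (T : ℝ) (E : Type*) [NormedAddCommGroup E] :
    ∃ K, 0 ≤ K ∧ ∀ f : L2 T E, ∫ s in Icc 0 T, ‖f s‖ ≤ K * ‖f‖ := by
  refine ⟨((volume.restrict (Icc (0 : ℝ) T)) univ ^ ((1 : ℝ) / (1 : ℝ≥0∞).toReal -
    1 / (2 : ℝ≥0∞).toReal)).toReal, ENNReal.toReal_nonneg, fun f => ?_⟩
  have h := eLpNorm_le_eLpNorm_mul_rpow_measure_univ (p := 1) (q := 2)
    (μ := volume.restrict (Icc (0 : ℝ) T)) (by norm_num) (Lp.aestronglyMeasurable f)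
  rw [integral_norm_eq_lintegral_enorm (Lp.aestronglyMeasurable f),
    ← eLpNorm_one_eq_lintegral_enorm, Lp.norm_def, mul_comm, ← ENNReal.toReal_mul]
  refine ENNReal.toReal_mono (ENNReal.mul_ne_top (Lp.eLpNorm_ne_top f) ?_) h
  exact ENNReal.rpow_ne_top_of_nonneg (by norm_num) (measure_ne_top _ _)

/-- The causal convolution with a strongly continuous family, as an operator on `L²`. -/
def convOp [CompleteSpace E] (T : ℝ) (Q : ℝ → E →L[ℂ] E') (hQ : ∀ x, Continuous fun t => Q t x) :
    L2 T E →L[ℂ] L2 T E' :=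
  LinearMap.mkContinuousOfExistsBound
    { toFun := fun f => (memLp_of_continuousOn (continuousOn_causalConv hQ f.integrableOn)).toLp
      map_add' := fun f g => by
        rw [← MemLp.toLp_add, MemLp.toLp_eq_toLp_iff]
        filter_upwards [ae_restrict_mem measurableSet_Icc] with t ht
        have h0 : (0 : ℝ) ∈ Icc 0 T := ⟨le_rfl, ht.1.trans ht.2⟩
        rw [Pi.add_apply]
        unfold causalConv
        rw [← intervalIntegral.integral_add (intervalIntegrable_kernel hQ t f.integrableOn h0 ht)
          (intervalIntegrable_kernel hQ t g.integrableOn h0 ht)]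
        refine intervalIntegral.integral_congr_ae ?_
        filter_upwards [ae_uIoc_of_ae_Icc (Lp.coeFn_add f g) h0 ht] with s hs hs'
        rw [hs hs', Pi.add_apply, map_add]
      map_smul' := fun c f => by
        rw [RingHom.id_apply, ← MemLp.toLp_const_smul, MemLp.toLp_eq_toLp_iff]
        filter_upwards [ae_restrict_mem measurableSet_Icc] with t ht
        have h0 : (0 : ℝ) ∈ Icc 0 T := ⟨le_rfl, ht.1.trans ht.2⟩
        rw [Pi.smul_apply]
        unfold causalConv
        rw [← intervalIntegral.integral_smul]
        refine intervalIntegral.integral_congr_ae ?_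
        filter_upwards [ae_uIoc_of_ae_Icc (Lp.coeFn_smul c f) h0 ht] with s hs hs'
        rw [hs hs', Pi.smul_apply, map_smul] } (by
    obtain ⟨M, hM0, hM⟩ := exists_norm_le_of_strongly_continuous hQ 0 T
    obtain ⟨K, hK0, hK⟩ := L2.integral_norm_le T E
    refine ⟨(measureUnivNNReal (volume.restrict (Icc (0 : ℝ) T)) : ℝ) ^ (2 : ℝ≥0∞).toReal⁻¹ *
      (M * K), fun f => (Lp.norm_le_of_ae_bound (C := M * (K * ‖f‖)) (by positivity) ?_).trans_eq
        (by ring)⟩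
    filter_upwards [MemLp.coeFn_toLp (memLp_of_continuousOn
      (continuousOn_causalConv hQ f.integrableOn)), ae_restrict_mem measurableSet_Icc] with t h ht
    refine (congrArg norm h).trans_le
      ((norm_causalConv_le hM f.integrableOn ht).trans (by gcongr; exact hK f)))

theorem coeFn_convOp [CompleteSpace E] (Q : ℝ → E →L[ℂ] E') (hQ : ∀ x, Continuous fun t => Q t x)
    (f : L2 T E) : convOp T Q hQ f =ᵐ[volume.restrict (Icc (0 : ℝ) T)] causalConv Q f :=
  MemLp.coeFn_toLp (memLp_of_continuousOn (continuousOn_causalConv hQ f.integrableOn))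

/-- The Volterra operator `f ↦ ∫₀^· f`. -/
def volterra (T : ℝ) (E : Type*) [NormedAddCommGroup E] [InnerProductSpace ℂ E]
    [CompleteSpace E] : L2 T E →L[ℂ] L2 T E :=
  convOp T (fun _ => ContinuousLinearMap.id ℂ E) fun _ => continuous_const

/-- The pointwise application of a bounded operator to the elements of `L²`. -/
def postcomp (T : ℝ) (L : E →L[ℂ] E') : L2 T E →L[ℂ] L2 T E' := L.compLpL 2 _

theorem coeFn_postcomp (L : E →L[ℂ] E') (f : L2 T E) :
    postcomp T L f =ᵐ[volume.restrict (Icc (0 : ℝ) T)] fun t => L (f t) :=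
  L.coeFn_compLpL f

theorem L2.integral_congr {f : L2 T E} {g : ℝ → E}
    (h : f =ᵐ[volume.restrict (Icc (0 : ℝ) T)] g) {a b : ℝ} (ha : a ∈ Icc 0 T) (hb : b ∈ Icc 0 T) :
    ∫ s in a..b, f s = ∫ s in a..b, g s :=
  intervalIntegral.integral_congr_ae (ae_uIoc_of_ae_Icc h ha hb)

theorem causalConv_congr {Q : ℝ → E →L[ℂ] E'} {f g : ℝ → E}
    (h : f =ᵐ[volume.restrict (Icc (0 : ℝ) T)] g) {t : ℝ} (ht : t ∈ Icc 0 T) :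
    causalConv Q f t = causalConv Q g t := by
  refine intervalIntegral.integral_congr_ae ?_
  filter_upwards [ae_uIoc_of_ae_Icc h ⟨le_rfl, ht.1.trans ht.2⟩ ht] with s hs hs'
  rw [hs hs']

/-- Makes equations in H⁻² between `secondDeriv` and `embedL2` of L² functions closed conditions. -/
theorem continuous_pairDeriv (k : Fin 3) : Continuous (pairDeriv (T := T) (E := E) k) := by
  have h : ∀ v : L2 T E, ‖pairDeriv k v‖ ≤
      ‖(PiLp.proj 2 (𝕜 := ℂ) (fun _ : Fin 3 => L2 T E) k).comp (H20r T E).subtypeL‖ * ‖v‖ := by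
    intro v
    refine (ContinuousLinearMap.opNorm_comp_le _ _).trans ?_
    rw [mul_comm]
    gcongr
    refine ContinuousLinearMap.opNorm_le_bound _ (norm_nonneg _) fun w => ?_
    rw [mul_comm]
    exact norm_inner_le_norm (𝕜 := ℂ) (w : L2 T E) v
  exact (LinearMap.mkContinuous (σ := RingHom.id ℂ) (E := L2 T E) (F := Hm20l T E)
    (pairDeriv k) _ h).continuous

section

variable [CompleteSpace E]

theorem coeFn_volterra (f : L2 T E) :
    volterra T E f =ᵐ[volume.restrict (Icc (0 : ℝ) T)] fun t => ∫ s in (0 : ℝ)..t, f s :=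
  coeFn_convOp _ _ f

theorem L2.continuousOn_integral (f : L2 T E) :
    ContinuousOn (fun t => ∫ s in (0 : ℝ)..t, f s) (Icc 0 T) :=
  continuousOn_causalConv (Q := fun _ => ContinuousLinearMap.id ℂ E) (fun _ => continuous_const)
    f.integrableOn

theorem integral_postcomp [CompleteSpace E'] (L : E →L[ℂ] E') (f : L2 T E) {a b : ℝ}
    (ha : a ∈ Icc 0 T) (hb : b ∈ Icc 0 T) :
    ∫ s in a..b, postcomp T L f s = L (∫ s in a..b, f s) := by
  rw [L2.integral_congr (coeFn_postcomp L f) ha hb]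
  exact ContinuousLinearMap.intervalIntegral_comp_comm _ (f.intervalIntegrable ha hb)

theorem volterra_postcomp [CompleteSpace E'] (L : E →L[ℂ] E') (f : L2 T E) :
    volterra T E' (postcomp T L f) = postcomp T L (volterra T E f) := by
  refine Lp.ext ?_
  filter_upwards [coeFn_volterra (postcomp T L f), coeFn_postcomp L (volterra T E f),
    coeFn_volterra f, ae_restrict_mem measurableSet_Icc] with t h1 h2 h3 ht
  rw [h1, h2, h3, integral_postcomp L f ⟨le_rfl, ht.1.trans ht.2⟩ ht]

theorem volterra_convOp [CompleteSpace E'] (Q : ℝ → E →L[ℂ] E')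
    (hQ : ∀ x, Continuous fun t => Q t x) (f : L2 T E) :
    volterra T E' (convOp T Q hQ f) = convOp T Q hQ (volterra T E f) := by
  refine Lp.ext ?_
  filter_upwards [coeFn_volterra (convOp T Q hQ f), coeFn_convOp Q hQ (volterra T E f),
    ae_restrict_mem measurableSet_Icc] with t h1 h2 ht
  rw [h1, h2, L2.integral_congr (coeFn_convOp Q hQ f) ⟨le_rfl, ht.1.trans ht.2⟩ ht,
    integral_causalConv hQ f.integrableOn ht, causalConv_congr (coeFn_volterra f) ht,
    causalConv_integral hQ f.integrableOn ht]

theorem volterra_injective (hT : 0 < T) : Function.Injective (volterra T E) := by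
  rw [injective_iff_map_eq_zero]
  intro f hf
  have h0 : (0 : ℝ) ∈ Icc 0 T := ⟨le_rfl, hT.le⟩
  have h1 : (fun t => ∫ s in (0 : ℝ)..t, f s) =ᵐ[volume.restrict (Icc (0 : ℝ) T)] 0 := by
    refine (coeFn_volterra f).symm.trans ?_
    rw [hf]
    exact Lp.coeFn_zero _ _ _
  -- The primitive is continuous, so it vanishes everywhere, and Lebesgue differentiation recovers f
  -- = 0.
  have h2 : EqOn (fun t => ∫ s in (0 : ℝ)..t, f s) 0 (Icc 0 T) :=
    Measure.eqOn_Icc_of_ae_eq volume hT.ne h1 f.continuousOn_integral continuousOn_const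
  have h3 := (f.intervalIntegrable h0 ⟨hT.le, le_rfl⟩).ae_hasDerivAt_integral
  refine Lp.ext ?_
  have h4 : ∀ᵐ s ∂(volume.restrict (Icc (0 : ℝ) T)), s ∈ Ioo 0 T := by
    rw [← restrict_Ioo_eq_restrict_Icc]
    exact ae_restrict_mem measurableSet_Ioo
  filter_upwards [h4, ae_restrict_of_ae h3, Lp.coeFn_zero E 2 (volume.restrict (Icc (0 : ℝ) T))]
    with t ht h hz
  rw [hz, Pi.zero_apply]
  rw [uIcc_of_le hT.le] at h
  refine (h (Ioo_subset_Icc_self ht) 0 h0).unique ((hasDerivAt_const t (0 : E)).congr_of_eventuallyEq ?_)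
  filter_upwards [Icc_mem_nhds ht.1 ht.2] with s hs using h2 hs

/-- Integration by parts: the two triangles on either side of the diagonal fill the square. The case
f = g gives accretivity, the general case the adjoint of the Volterra operator. -/
theorem inner_volterra_add (f g : L2 T E) (hT : 0 ≤ T) :
    inner ℂ (volterra T E f) g + inner ℂ f (volterra T E g) =
      inner ℂ (∫ s in (0 : ℝ)..T, f s) (∫ s in (0 : ℝ)..T, g s) := by
  have h0 : (0 : ℝ) ∈ Icc 0 T := ⟨le_rfl, hT⟩
  have hTT : T ∈ Icc 0 T := ⟨hT, le_rfl⟩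
  have hi : Integrable (Function.uncurry fun s r => (inner ℂ (f r) (g s) : ℂ))
      ((volume.restrict (Ioc 0 T)).prod (volume.restrict (Ioc 0 T))) := by
    refine Integrable.op_fst_snd (op := fun (x y : E) => (inner ℂ y x : ℂ)) (by fun_prop)
      ⟨1, fun x y => ?_⟩ (g.integrableOn.mono_set Ioc_subset_Icc_self)
      (f.integrableOn.mono_set Ioc_subset_Icc_self)
    rw [one_mul, mul_comm]
    exact norm_inner_le_norm _ _
  have hin : ∀ (r a b : ℝ), a ∈ Icc 0 T → b ∈ Icc 0 T →
      IntervalIntegrable (fun s => (inner ℂ (f r) (g s) : ℂ)) volume a b := fun r a b ha hb =>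
    ⟨(g.intervalIntegrable ha hb).1.const_inner _, (g.intervalIntegrable ha hb).2.const_inner _⟩
  have hin' : ∀ (r a b : ℝ), a ∈ Icc 0 T → b ∈ Icc 0 T →
      ∫ s in a..b, (inner ℂ (f r) (g s) : ℂ) = inner ℂ (f r) (∫ s in a..b, g s) :=
    fun r a b ha hb => ContinuousLinearMap.intervalIntegral_comp_comm (innerSL ℂ (f r))
      (g.intervalIntegrable ha hb)
  have hin'' : ∀ (b : ℝ) (y : E), b ∈ Icc 0 T →
      ∫ s in (0 : ℝ)..b, (inner ℂ (f s) y : ℂ) = inner ℂ (∫ s in (0 : ℝ)..b, f s) y := by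
    intro b y hb
    have := integral_inner (𝕜 := ℂ) (f.intervalIntegrable h0 hb).1 y
    rw [intervalIntegral.integral_of_le hb.1, intervalIntegral.integral_of_le hb.1,
      ← inner_conj_symm, ← this, ← integral_conj]
    simp
  have e1 : (inner ℂ (volterra T E f) g : ℂ) =
      ∫ s in (0 : ℝ)..T, ∫ r in (0 : ℝ)..s, inner ℂ (f r) (g s) := by
    rw [L2.inner_def, intervalIntegral.integral_of_le hT, ← integral_Icc_eq_integral_Ioc]
    refine integral_congr_ae ?_
    filter_upwards [coeFn_volterra f, ae_restrict_mem measurableSet_Icc] with s hs hs'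
    rw [hs, hin'' s (g s) hs']
  have e2 : (inner ℂ f (volterra T E g) : ℂ) =
      ∫ r in (0 : ℝ)..T, ∫ s in (0 : ℝ)..r, inner ℂ (f r) (g s) := by
    rw [L2.inner_def, intervalIntegral.integral_of_le hT, ← integral_Icc_eq_integral_Ioc]
    refine integral_congr_ae ?_
    filter_upwards [coeFn_volterra g, ae_restrict_mem measurableSet_Icc] with s hs hs'
    rw [hs, hin' s 0 s h0 hs']
  have e3 : (inner ℂ (∫ s in (0 : ℝ)..T, f s) (∫ s in (0 : ℝ)..T, g s) : ℂ) =
      ∫ r in (0 : ℝ)..T, ∫ s in (0 : ℝ)..T, inner ℂ (f r) (g s) := by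
    rw [← hin'' T _ hTT]
    exact intervalIntegral.integral_congr fun r _ => (hin' r 0 T h0 hTT).symm
  have hA : IntervalIntegrable (fun r => ∫ s in (0 : ℝ)..r, (inner ℂ (f r) (g s) : ℂ))
      volume 0 T := by
    rw [intervalIntegrable_iff_integrableOn_Icc_of_le hT]
    refine (L2.integrable_inner (𝕜 := ℂ) f (volterra T E g)).congr ?_
    filter_upwards [coeFn_volterra g, ae_restrict_mem measurableSet_Icc] with r hr hr'
    rw [hr, hin' r 0 r h0 hr']
  have hB : IntervalIntegrable (fun r => ∫ s in (0 : ℝ)..T, (inner ℂ (f r) (g s) : ℂ))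
      volume 0 T := by
    rw [intervalIntegrable_iff_integrableOn_Icc_of_le hT]
    refine (f.integrableOn.inner_const (𝕜 := ℂ) (∫ s in (0 : ℝ)..T, g s)).congr ?_
    exact .of_forall fun r => (hin' r 0 T h0 hTT).symm
  rw [e1, e2, e3, integral_triangle_swap hT hi, ← eq_sub_iff_add_eq,
    ← intervalIntegral.integral_sub hB hA]
  refine intervalIntegral.integral_congr fun r hr => ?_
  rw [uIcc_of_le hT] at hr
  rw [eq_sub_iff_add_eq, add_comm]
  exact intervalIntegral.integral_add_adjacent_intervals (hin _ _ _ h0 hr) (hin _ _ _ hr hTT)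

theorem volterra_accretive (hT : 0 ≤ T) (f : L2 T E) :
    0 ≤ (inner ℂ (volterra T E f) f : ℂ).re := by
  have h := congrArg Complex.re (inner_volterra_add f f hT)
  rw [Complex.add_re, ← inner_conj_symm f, Complex.conj_re, inner_self_eq_norm_sq_to_K] at h
  have h2 : ((RCLike.ofReal ‖∫ s in (0 : ℝ)..T, f s‖ : ℂ) ^ 2).re =
      ‖∫ s in (0 : ℝ)..T, f s‖ ^ 2 := by
    rw [show (RCLike.ofReal ‖∫ s in (0 : ℝ)..T, f s‖ : ℂ) ^ 2 =
      ((‖∫ s in (0 : ℝ)..T, f s‖ ^ 2 : ℝ) : ℂ) by push_cast; rfl, Complex.ofReal_re]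
  rw [h2] at h
  nlinarith [sq_nonneg ‖∫ s in (0 : ℝ)..T, f s‖]

/-- The witness is t ↦ ∫₀ᵗ f − ∫₀ᵀ f, the negative of the adjoint Volterra operator applied to f.
Iterating it produces test functions in `H20r` with a prescribed second derivative. -/
theorem exists_isPrimitiveFrom_right (hT : 0 ≤ T) (f : L2 T E) : ∃ g : L2 T E,
    IsPrimitiveFrom T g f ∧ ∀ v : L2 T E, (inner ℂ g v : ℂ) = -inner ℂ f (volterra T E v) := by
  have h0 : (0 : ℝ) ∈ Icc 0 T := ⟨le_rfl, hT⟩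
  have hTT : T ∈ Icc 0 T := ⟨hT, le_rfl⟩
  set m := ∫ s in (0 : ℝ)..T, f s with hm
  have hc : MemLp (fun _ : ℝ => m) 2 (volume.restrict (Icc (0 : ℝ) T)) := memLp_const m
  have hg : ((volterra T E f - hc.toLp : L2 T E)) =ᵐ[volume.restrict (Icc (0 : ℝ) T)]
      fun t => (∫ s in (0 : ℝ)..t, f s) - m := by
    filter_upwards [Lp.coeFn_sub (volterra T E f) hc.toLp, coeFn_volterra f, hc.coeFn_toLp]
      with t h1 h2 h3
    rw [h1, Pi.sub_apply, h2, h3]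
  refine ⟨volterra T E f - hc.toLp, ?_, fun v => ?_⟩
  · filter_upwards [hg, ae_restrict_mem measurableSet_Icc] with t ht ht'
    rw [ht, sub_eq_iff_eq_add', hm, intervalIntegral.integral_add_adjacent_intervals
      (f.intervalIntegrable h0 hTT) (f.intervalIntegrable hTT ht')]
  · have h1 : (inner ℂ (hc.toLp : L2 T E) v : ℂ) = inner ℂ m (∫ s in (0 : ℝ)..T, v s) := by
      rw [L2.inner_def, intervalIntegral.integral_of_le hT, ← integral_Icc_eq_integral_Ioc,
        ← integral_inner v.integrableOn]
      refine integral_congr_ae ?_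
      filter_upwards [hc.coeFn_toLp] with t ht
      rw [ht]
    rw [inner_sub_left, h1, ← inner_volterra_add f v hT]
    ring

/-- If the second derivative of `p`, in the sense of functionals on `H²_{0r}`, is `y ∈ L²`,
then `p` is the second integral of `y`. -/
theorem eq_volterra_of_secondDeriv_eq (hT : 0 ≤ T) {p y : L2 T E}
    (h : secondDeriv p = embedL2 y) : p = volterra T E (volterra T E y) := by
  -- Every w₂ ∈ L² is the second derivative of a test function; the signs from the two integrations
  -- by parts cancel.
  refine ext_inner_left ℂ fun w₂ => ?_
  obtain ⟨w₁, h₁, h₁'⟩ := exists_isPrimitiveFrom_right hT w₂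
  obtain ⟨w₀, h₀, h₀'⟩ := exists_isPrimitiveFrom_right hT w₁
  have := DFunLike.congr_fun h (⟨WithLp.toLp 2 ![w₀, w₁, w₂], h₁, h₀⟩ : H20r T E)
  rw [secondDeriv_apply, embedL2_apply] at this
  refine this.trans ((h₀' y).trans ?_)
  rw [h₁', neg_neg]

end

end L2Operators

namespace SystemNode

variable {X U Y Z : Type*}
  [NormedAddCommGroup X] [InnerProductSpace ℂ X] [CompleteSpace X]
  [NormedAddCommGroup U] [InnerProductSpace ℂ U] [CompleteSpace U]
  [NormedAddCommGroup Y] [InnerProductSpace ℂ Y] [CompleteSpace Y]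
  [NormedAddCommGroup Z] [InnerProductSpace ℂ Z] [CompleteSpace Z]
  {S : SystemNode X U Y} (α : S.ResolventPoint)

/-! ### The system node in resolvent coordinates -/

/-- The bounded operator `(α I - A₋₁)⁻¹ B : U → X`. -/
def resolventControl : U →L[ℂ] X :=
  ((shiftExtrap α).symm : Extrap α →L[ℂ] X).comp (control α)

/-- The hypothesis is y = A₋₁ x + B u after applying the resolvent. Subtracting any point of
dom(A&B) over the same u reduces the claim to the graph of A. -/
theorem mem_graph_AB {x y : X} {u : U}
    (h : resolvent α ((α.1 : ℂ) • x - y) + resolventControl α u = x) :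
    ((x, u), y) ∈ S.AB.graph := by
  obtain ⟨x', hx'⟩ := S.exists_mem u
  set y' := S.AB ⟨(x', u), hx'⟩ with hy'
  have h' : resolvent α y' = (α.1 : ℂ) • resolvent α x' - x' + resolventControl α u :=
    control_spec α hx'
  have hg : (x - x', y - y') ∈ S.A.graph := by
    rw [mem_graph_iff_resolvent α]
    have : (α.1 : ℂ) • (x - x') - (y - y') = ((α.1 : ℂ) • x - y) - (α.1 : ℂ) • x' + y' := by
      rw [smul_sub]
      abel
    rw [this, map_add, map_sub, h', eq_sub_of_add_eq h, map_smul]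
    abel
  have h2 := S.AB.graph.add_mem ((S.mem_graph_A).1 hg) (LinearPMap.mem_graph S.AB ⟨(x', u), hx'⟩)
  simpa [← hy'] using h2

theorem resolventControl_mem_graph (u : U) :
    ((resolventControl α u, u), (α.1 : ℂ) • resolventControl α u) ∈ S.AB.graph :=
  mem_graph_AB α (by simp)

theorem resolventControl_mem (u : U) : (resolventControl α u, u) ∈ S.AB.domain :=
  LinearPMap.mem_domain_of_mem_graph (resolventControl_mem_graph α u)

/-- The transfer function `C&D ((α I - A₋₁)⁻¹ B, I)` at `α`. -/
def transfer : U →L[ℂ] Y :=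
  LinearMap.mkContinuousOfExistsBound
    (S.CD ∘ₗ (((resolventControl α).prod (ContinuousLinearMap.id ℂ U) :
      U →L[ℂ] X × U) : U →ₗ[ℂ] X × U).codRestrict S.AB.domain (resolventControl_mem α)) (by
    obtain ⟨K, hK⟩ := S.bounded_CD
    refine ⟨|K| * (‖(resolventControl α).prod (ContinuousLinearMap.id ℂ U)‖ +
      ‖(α.1 : ℂ) • resolventControl α‖), fun u => ?_⟩
    -- On the vectors ((α I - A₋₁)⁻¹ B u, u) the operator A&B is multiplication by α of the first
    -- entry, so their graph norm is bounded by ‖u‖.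
    have hA : S.AB ⟨(resolventControl α u, u), resolventControl_mem α u⟩ =
        ((α.1 : ℂ) • resolventControl α) u := by
      obtain ⟨p, hp, hp'⟩ := (LinearPMap.mem_graph_iff _).1 (resolventControl_mem_graph α u)
      refine Eq.trans (congrArg _ (Subtype.ext hp.symm)) hp'
    refine (hK ⟨(resolventControl α u, u), resolventControl_mem α u⟩).trans ?_
    rw [hA, mul_assoc]
    refine mul_le_mul (le_abs_self K) ?_ (by positivity) (abs_nonneg K)
    rw [add_mul]
    exact add_le_add (((resolventControl α).prod (ContinuousLinearMap.id ℂ U)).le_opNorm u)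
      (ContinuousLinearMap.le_opNorm _ _))

theorem transfer_apply (u : U) :
    transfer α u = S.CD ⟨(resolventControl α u, u), resolventControl_mem α u⟩ := rfl

/-- Decompose (x, u) = (r, 0) + ((α I - A₋₁)⁻¹ B u, u) with r in dom A; C&D is bounded in terms of α
x - y on the first part and of u on the second. -/
theorem exists_mem_AB {x y : X} {u : U}
    (h : resolvent α ((α.1 : ℂ) • x - y) + resolventControl α u = x) :
    ∃ h : (x, u) ∈ S.AB.domain, y = S.AB ⟨(x, u), h⟩ ∧
      CResolvent α ((α.1 : ℂ) • x - y) + transfer α u = S.CD ⟨(x, u), h⟩ := by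
  obtain ⟨⟨p, hpm⟩, hp, hp'⟩ := (LinearPMap.mem_graph_iff _).1 (mem_graph_AB α h)
  simp only at hp
  subst hp
  refine ⟨hpm, hp'.symm, ?_⟩
  rw [transfer_apply]
  change S.CD ⟨(resolvent α ((α.1 : ℂ) • x - y), 0), resolvent_mem α _⟩ + _ = _
  rw [← map_add]
  congr 1
  exact Subtype.ext (Prod.ext h (zero_add u))

/-! ### Mild solutions -/

/-- `∫₀ᵗ 𝔄(t - s) (α I - A₋₁)⁻¹ B u(s) ds = (α I - A₋₁)⁻¹ 𝔅_t u`. -/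
def mild {T : ℝ} (u : L2 T U) (t : ℝ) : X :=
  causalConv (fun r => S.semigroup.op r.toNNReal) (fun s => resolventControl α (u s)) t

theorem inputState_eq {T : ℝ} (u : L2 T U) (t : ℝ) :
    inputState α t u = shiftExtrap α (mild α u t) := rfl

theorem integrableOn_resolventControl {T : ℝ} (u : L2 T U) :
    IntegrableOn (fun s => resolventControl α (u s)) (Icc 0 T) :=
  (resolventControl α).integrable_comp u.integrableOn

theorem continuousOn_mild {T : ℝ} (u : L2 T U) : ContinuousOn (mild α u) (Icc 0 T) :=
  continuousOn_causalConv S.semigroup.continuous_orbit (integrableOn_resolventControl α u)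

/-- `u ↦ mild u` as an operator on `L²`. -/
def mildOp (T : ℝ) : L2 T U →L[ℂ] L2 T X :=
  (convOp T (fun r => S.semigroup.op r.toNNReal) S.semigroup.continuous_orbit).comp
    (postcomp T (resolventControl α))

variable {T : ℝ}

theorem coeFn_mildOp (u : L2 T U) :
    mildOp α T u =ᵐ[volume.restrict (Icc (0 : ℝ) T)] mild α u := by
  filter_upwards [coeFn_convOp (fun r => S.semigroup.op r.toNNReal) S.semigroup.continuous_orbit
    (postcomp T (resolventControl α) u), ae_restrict_mem measurableSet_Icc] with t h1 ht
  exact h1.trans (causalConv_congr (coeFn_postcomp _ u) ht)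

theorem volterra_mildOp (u : L2 T U) :
    volterra T X (mildOp α T u) = mildOp α T (volterra T U u) := by
  unfold mildOp
  rw [ContinuousLinearMap.comp_apply, ContinuousLinearMap.comp_apply, volterra_convOp,
    volterra_postcomp]

/-- The derivative of the state for the input `∫₀^· ∫₀^· u`. -/
def velocity (u : L2 T U) (t : ℝ) : X :=
  (α.1 : ℂ) • (∫ s in (0 : ℝ)..t, mildOp α T u s) - mild α u t +
    resolventControl α (∫ s in (0 : ℝ)..t, u s)

/-- The state for the input `∫₀^· ∫₀^· u`. -/
def position (u : L2 T U) (t : ℝ) : X :=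
  (α.1 : ℂ) • (∫ s in (0 : ℝ)..t, volterra T X (mildOp α T u) s) -
    (∫ s in (0 : ℝ)..t, mildOp α T u s) +
    resolventControl α (∫ s in (0 : ℝ)..t, volterra T U u s)

/-- `velocity` as an operator on `L²`. -/
def velocityOp (T : ℝ) : L2 T U →L[ℂ] L2 T X :=
  (α.1 : ℂ) • (volterra T X).comp (mildOp α T) - mildOp α T +
    (postcomp T (resolventControl α)).comp (volterra T U)

theorem coeFn_velocityOp (u : L2 T U) :
    velocityOp α T u =ᵐ[volume.restrict (Icc (0 : ℝ) T)] velocity α u := by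
  set a : L2 T X := (α.1 : ℂ) • volterra T X (mildOp α T u)
  set b : L2 T X := mildOp α T u
  set c : L2 T X := postcomp T (resolventControl α) (volterra T U u)
  have h : velocityOp α T u = a - b + c := rfl
  rw [h]
  filter_upwards [Lp.coeFn_add (a - b) c, Lp.coeFn_sub a b,
    Lp.coeFn_smul (α.1 : ℂ) (volterra T X (mildOp α T u)), coeFn_volterra (mildOp α T u),
    coeFn_mildOp α u, coeFn_postcomp (resolventControl α) (volterra T U u), coeFn_volterra u]
    with t h1 h2 h3 h4 h5 h6 h7
  rw [h1, Pi.add_apply, h2, Pi.sub_apply, h3, Pi.smul_apply, h4, h5, h6, h7]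
  rfl

/-- For each s, A ∫₀ʰ 𝔄(r) f(s) dr = 𝔄(h) f(s) - f(s) with h = t - s and f = (α I - A₋₁)⁻¹ B u. In
resolvent form this is integrated over s. -/
theorem resolvent_velocity (u : L2 T U) {t : ℝ} (ht : t ∈ Icc 0 T) :
    resolvent α (velocity α u t) = ∫ s in (0 : ℝ)..t, mildOp α T u s := by
  have h0 : (0 : ℝ) ∈ Icc 0 T := ⟨le_rfl, ht.1.trans ht.2⟩
  set f : ℝ → X := fun s => resolventControl α (u s)
  set Q : ℝ → X →L[ℂ] X := fun r => S.semigroup.op r.toNNReal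
  have hQ : ∀ x, Continuous fun t => Q t x := S.semigroup.continuous_orbit
  have hf : IntegrableOn f (Icc 0 T) := integrableOn_resolventControl α u
  have h1 : ∫ s in (0 : ℝ)..t, mildOp α T u s =
      ∫ s in (0 : ℝ)..t, ∫ r in (0 : ℝ)..(t - s), Q r (f s) := by
    rw [L2.integral_congr (coeFn_mildOp α u) h0 ht]
    exact integral_causalConv hQ hf ht
  have hi1 := intervalIntegrable_integral_kernel hQ hf ht
  have hi1' : IntervalIntegrable
      (fun s => (α.1 : ℂ) • ∫ r in (0 : ℝ)..(t - s), Q r (f s)) volume 0 t := hi1.smul _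
  have hi2 := intervalIntegrable_kernel hQ t hf h0 ht
  have hi3 : IntervalIntegrable f volume 0 t :=
    (hf.mono_set (uIcc_subset_Icc h0 ht)).intervalIntegrable
  have h2 : velocity α u t = ∫ s in (0 : ℝ)..t,
      ((α.1 : ℂ) • (∫ r in (0 : ℝ)..(t - s), Q r (f s)) - Q (t - s) (f s) + f s) := by
    rw [intervalIntegral.integral_add (hi1'.sub hi2) hi3,
      intervalIntegral.integral_sub hi1' hi2, intervalIntegral.integral_smul, ← h1]
    unfold velocity
    rw [← ContinuousLinearMap.intervalIntegral_comp_comm _ (u.intervalIntegrable h0 ht)]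
    rfl
  rw [h1, h2, ← ContinuousLinearMap.intervalIntegral_comp_comm _ ((hi1'.sub hi2).add hi3)]
  refine intervalIntegral.integral_congr fun s hs => ?_
  rw [uIcc_of_le ht.1] at hs
  have := (mem_graph_iff_resolvent α).1
    (S.isGenerator.integral_graph (f s) (sub_nonneg.2 hs.2))
  rwa [← sub_add] at this

/-- Makes `velocity` the time derivative of `position`. -/
theorem position_eq_integral (u : L2 T U) {t : ℝ} (ht : t ∈ Icc 0 T) :
    position α u t = ∫ s in (0 : ℝ)..t, velocityOp α T u s := by
  have h0 : (0 : ℝ) ∈ Icc 0 T := ⟨le_rfl, ht.1.trans ht.2⟩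
  set a : L2 T X := volterra T X (mildOp α T u)
  set b : L2 T X := mildOp α T u
  set c : L2 T X := postcomp T (resolventControl α) (volterra T U u)
  have h : velocityOp α T u = (α.1 : ℂ) • a - b + c := rfl
  have h2 : velocityOp α T u =ᵐ[volume.restrict (Icc (0 : ℝ) T)]
      fun s => (α.1 : ℂ) • a s - b s + c s := by
    rw [h]
    filter_upwards [Lp.coeFn_add ((α.1 : ℂ) • a - b) c, Lp.coeFn_sub ((α.1 : ℂ) • a) b,
      Lp.coeFn_smul (α.1 : ℂ) a] with t h1 h2 h3
    rw [h1, Pi.add_apply, h2, Pi.sub_apply, h3, Pi.smul_apply]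
  have ia : IntervalIntegrable (fun s => (α.1 : ℂ) • a s) volume 0 t :=
    (a.intervalIntegrable h0 ht).smul _
  have ib := b.intervalIntegrable h0 ht
  rw [L2.integral_congr h2 h0 ht, intervalIntegral.integral_add (ia.sub ib)
    (c.intervalIntegrable h0 ht), intervalIntegral.integral_sub ia ib,
    intervalIntegral.integral_smul, integral_postcomp _ _ h0 ht]
  rfl

theorem postcomp_resolvent_velocityOp (u : L2 T U) :
    postcomp T (resolvent α) (velocityOp α T u) = volterra T X (mildOp α T u) := by
  refine Lp.ext ?_
  filter_upwards [coeFn_postcomp (resolvent α) (velocityOp α T u), coeFn_velocityOp α u,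
    coeFn_volterra (mildOp α T u), ae_restrict_mem measurableSet_Icc] with t h1 h2 h3 ht
  rw [h1, h2, h3, resolvent_velocity α u ht]

theorem resolvent_position (u : L2 T U) {t : ℝ} (ht : t ∈ Icc 0 T) :
    resolvent α (position α u t) = ∫ s in (0 : ℝ)..t, volterra T X (mildOp α T u) s := by
  have h0 : (0 : ℝ) ∈ Icc 0 T := ⟨le_rfl, ht.1.trans ht.2⟩
  rw [position_eq_integral α u ht, ← integral_postcomp _ _ h0 ht, postcomp_resolvent_velocityOp]

/-- The output for the input `∫₀^· ∫₀^· u`. -/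
def output (u : L2 T U) (t : ℝ) : Y :=
  CResolvent α ((α.1 : ℂ) • position α u t - velocity α u t) +
    transfer α (∫ s in (0 : ℝ)..t, volterra T U u s)

/-- Once `resolvent_position` and `resolvent_velocity` are inserted, the resolvent form of x' = A₋₁
x + B V²u is the definition of `position`. -/
theorem position_mem (u : L2 T U) {t : ℝ} (ht : t ∈ Icc 0 T) :
    ∃ h : (position α u t, ∫ s in (0 : ℝ)..t, volterra T U u s) ∈ S.AB.domain,
      velocity α u t = S.AB ⟨_, h⟩ ∧ output α u t = S.CD ⟨_, h⟩ := by
  refine exists_mem_AB α ?_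
  rw [map_sub, map_smul, resolvent_position α u ht, resolvent_velocity α u ht]
  rfl

/-- `output` as an operator on `L²`. -/
def outputOp (T : ℝ) : L2 T U →L[ℂ] L2 T Y :=
  (postcomp T (CResolvent α)).comp
    ((α.1 : ℂ) • (volterra T X).comp (velocityOp α T) - velocityOp α T) +
    (postcomp T (transfer α)).comp ((volterra T U).comp (volterra T U))

theorem coeFn_outputOp (u : L2 T U) :
    outputOp α T u =ᵐ[volume.restrict (Icc (0 : ℝ) T)] output α u := by
  set a : L2 T X := volterra T X (velocityOp α T u)
  set b : L2 T X := velocityOp α T u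
  set c : L2 T Y := postcomp T (transfer α) (volterra T U (volterra T U u))
  have h : outputOp α T u = postcomp T (CResolvent α) ((α.1 : ℂ) • a - b) + c := rfl
  rw [h]
  filter_upwards [Lp.coeFn_add (postcomp T (CResolvent α) ((α.1 : ℂ) • a - b)) c,
    coeFn_postcomp (CResolvent α) ((α.1 : ℂ) • a - b), Lp.coeFn_sub ((α.1 : ℂ) • a) b,
    Lp.coeFn_smul (α.1 : ℂ) a, coeFn_volterra (velocityOp α T u), coeFn_velocityOp α u,
    coeFn_postcomp (transfer α) (volterra T U (volterra T U u)), coeFn_volterra (volterra T U u),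
    ae_restrict_mem measurableSet_Icc] with t h1 h2 h3 h4 h5 h6 h7 h8 ht
  rw [h1, Pi.add_apply, h2, h3, Pi.sub_apply, h4, Pi.smul_apply, h5, h6, h7, h8,
    ← position_eq_integral α u ht]
  rfl

theorem volterra_velocityOp (u : L2 T U) :
    volterra T X (velocityOp α T u) = velocityOp α T (volterra T U u) := by
  simp only [velocityOp, add_apply, sub_apply,
    smul_apply, ContinuousLinearMap.comp_apply, map_add, map_sub, map_smul,
    volterra_mildOp, volterra_postcomp]

/-- Time invariance: every building block is a causal convolution or a pointwise operator, and these
commute with integration. It yields the V-invariance of `regularPairs`. -/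
theorem volterra_outputOp (u : L2 T U) :
    volterra T Y (outputOp α T u) = outputOp α T (volterra T U u) := by
  simp only [outputOp, add_apply, sub_apply,
    smul_apply, ContinuousLinearMap.comp_apply, map_add, map_sub, map_smul,
    volterra_velocityOp, volterra_postcomp]

theorem integral_sub_smul {E : Type*} [NormedAddCommGroup E] [InnerProductSpace ℂ E]
    [CompleteSpace E] {f : ℝ → E} (hf : IntegrableOn f (Icc 0 T)) {t : ℝ} (ht : t ∈ Icc 0 T) :
    ∫ s in (0 : ℝ)..t, (t - s) • f s = ∫ s in (0 : ℝ)..t, ∫ r in (0 : ℝ)..s, f r := by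
  have := integral_causalConv (Q := fun _ => ContinuousLinearMap.id ℂ E)
    (fun _ => continuous_const) hf ht
  simpa [causalConv] using this.symm

/-- The second integral of 𝔅 u in X₋₁ is the image of `position`, and the embedding of X is
injective, so the vector in the definition of 𝔇_T is forced. Thus 𝔇_T is everywhere defined and is
the second derivative of a bounded operator on L². -/
theorem isInputOutput_iff (u : L2 T U) (ξ : Hm20l T Y) :
    IsInputOutput α u ξ ↔ ξ = secondDeriv (outputOp α T u) := by
  have key : ∀ t ∈ Icc 0 T, (∫ τ in (0 : ℝ)..t, (t - τ) • u τ) =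
        (∫ s in (0 : ℝ)..t, volterra T U u s) ∧
      toExtrap α (position α u t) = ∫ τ in (0 : ℝ)..t, (t - τ) • inputState α τ u := by
    intro t ht
    have h0 : (0 : ℝ) ∈ Icc 0 T := ⟨le_rfl, ht.1.trans ht.2⟩
    constructor
    · rw [integral_sub_smul u.integrableOn ht, L2.integral_congr (coeFn_volterra u) h0 ht]
    · have h1 : (∫ τ in (0 : ℝ)..t, (t - τ) • inputState α τ u) =
          shiftExtrap α (∫ τ in (0 : ℝ)..t, (t - τ) • mild α u τ) := rfl
      rw [h1, integral_sub_smul ((continuousOn_mild α u).integrableOn_Icc) ht]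
      change shiftExtrap α (resolvent α (position α u t)) = _
      rw [resolvent_position α u ht, L2.integral_congr (coeFn_volterra _) h0 ht]
      congr 1
      refine intervalIntegral.integral_congr fun s hs => ?_
      rw [uIcc_of_le ht.1] at hs
      exact L2.integral_congr (coeFn_mildOp α u) h0 ⟨hs.1, hs.2.trans ht.2⟩
  constructor
  · rintro ⟨p, rfl, hp⟩
    congr 1
    refine Lp.ext ?_
    filter_upwards [hp, coeFn_outputOp α u, ae_restrict_mem measurableSet_Icc]
      with t ⟨z, h, hz, hpt⟩ ho ht
    obtain ⟨k1, k2⟩ := key t ht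
    obtain ⟨h', -, h2⟩ := position_mem α u ht
    have hzp : z = position α u t := toExtrap_injective α (hz.trans k2.symm)
    rw [hpt, ho, h2]
    congr 1
    exact Subtype.ext (Prod.ext hzp k1)
  · rintro rfl
    refine ⟨_, rfl, ?_⟩
    filter_upwards [coeFn_outputOp α u, ae_restrict_mem measurableSet_Icc] with t ho ht
    obtain ⟨k1, k2⟩ := key t ht
    obtain ⟨h', -, h2⟩ := position_mem α u ht
    refine ⟨position α u t, k1 ▸ h', k2, ?_⟩
    rw [ho, h2]
    congr 1
    exact Subtype.ext (Prod.ext rfl k1.symm)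

end SystemNode

theorem L2.hasDerivWithinAt_integral {E : Type*} [NormedAddCommGroup E] [InnerProductSpace ℂ E]
    [CompleteSpace E] {T : ℝ} {f : L2 T E} {g : ℝ → E} (hg : ContinuousOn g (Icc 0 T))
    (h : f =ᵐ[volume.restrict (Icc (0 : ℝ) T)] g) {t : ℝ} (ht : t ∈ Icc 0 T) :
    HasDerivWithinAt (fun t => ∫ s in (0 : ℝ)..t, f s) (g t) (Icc 0 T) t := by
  have h0 : (0 : ℝ) ∈ Icc 0 T := ⟨le_rfl, ht.1.trans ht.2⟩
  have : Fact (t ∈ Icc 0 T) := ⟨ht⟩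
  refine (intervalIntegral.integral_hasDerivWithinAt_right (s := Icc 0 T) (t := Icc 0 T)
    ((hg.mono (uIcc_subset_Icc h0 ht)).intervalIntegrable)
    (hg.stronglyMeasurableAtFilter_nhdsWithin measurableSet_Icc t) (hg t ht)).congr
    (fun s hs => L2.integral_congr h h0 hs) (L2.integral_congr h h0 ht)

theorem eLpNorm_sub_eq_zero_of_ae_eq {E : Type*} [NormedAddCommGroup E] {μ : Measure ℝ}
    {p : ℝ≥0∞} {f g : ℝ → E} (h : g =ᵐ[μ] f) : eLpNorm (fun t => f t - g t) p μ = 0 := by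
  rw [eLpNorm_congr_ae (g := 0), eLpNorm_zero]
  filter_upwards [h] with t ht
  simp [ht]

namespace SystemNode

variable {X U Y Z : Type*}
  [NormedAddCommGroup X] [InnerProductSpace ℂ X] [CompleteSpace X]
  [NormedAddCommGroup U] [InnerProductSpace ℂ U] [CompleteSpace U]
  [NormedAddCommGroup Y] [InnerProductSpace ℂ Y] [CompleteSpace Y]
  [NormedAddCommGroup Z] [InnerProductSpace ℂ Z]
  {S : SystemNode X U Y} (α : S.ResolventPoint) {T : ℝ}

/-! ### Smooth trajectories and coercivity -/

theorem continuousOn_velocity (u : L2 T U) : ContinuousOn (velocity α u) (Icc 0 T) :=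
  ((((mildOp α T u).continuousOn_integral).const_smul (α.1 : ℂ)).sub
    (continuousOn_mild α u)).add
      ((resolventControl α).continuous.comp_continuousOn u.continuousOn_integral)

theorem continuousOn_position (u : L2 T U) : ContinuousOn (position α u) (Icc 0 T) :=
  ((((volterra T X (mildOp α T u)).continuousOn_integral).const_smul (α.1 : ℂ)).sub
    (mildOp α T u).continuousOn_integral).add
      ((resolventControl α).continuous.comp_continuousOn
        (volterra T U u).continuousOn_integral)

theorem continuousOn_output (u : L2 T U) : ContinuousOn (output α u) (Icc 0 T) :=
  ((CResolvent α).continuous.comp_continuousOn (((continuousOn_position α u).const_smul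
    (α.1 : ℂ)).sub (continuousOn_velocity α u))).add
      ((transfer α).continuous.comp_continuousOn (volterra T U u).continuousOn_integral)

/-- Twice integrated inputs are smooth enough for classical trajectories from 0; the coercivity of
trajectories is tested on these alone. -/
theorem isClassicalTrajectory_position (u : L2 T U) :
    S.IsClassicalTrajectory T (position α u) (fun t => ∫ s in (0 : ℝ)..t, volterra T U u s)
      (output α u) := by
  refine ⟨(volterra T U u).continuousOn_integral, continuousOn_output α u, velocity α u,
    continuousOn_velocity α u, fun t ht => ⟨?_, position_mem α u ht⟩⟩
  exact (L2.hasDerivWithinAt_integral (continuousOn_velocity α u) (coeFn_velocityOp α u) ht).congr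
    (fun s hs => position_eq_integral α u hs) (position_eq_integral α u ht)

theorem isGeneralizedTrajectory_position (u : L2 T U) :
    S.IsGeneralizedTrajectory T (position α u) (volterra T U (volterra T U u))
      (outputOp α T u) := by
  refine ⟨fun _ => position α u, fun _ t => ∫ s in (0 : ℝ)..t, volterra T U u s,
    fun _ => output α u, fun _ => isClassicalTrajectory_position α u, ?_, ?_, ?_⟩
  · exact fun s hs => .of_forall fun _ _ _ => refl_mem_uniformity hs
  · exact tendsto_const_nhds.congr fun _ => (eLpNorm_sub_eq_zero_of_ae_eq (coeFn_volterra _)).symm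
  · exact tendsto_const_nhds.congr fun _ => (eLpNorm_sub_eq_zero_of_ae_eq (coeFn_outputOp α u)).symm

theorem position_smul (c : ℂ) (u : L2 T U) {t : ℝ} (ht : t ∈ Icc 0 T) :
    position α (c • u) t = c • position α u t := by
  rw [position_eq_integral α _ ht, position_eq_integral α _ ht, map_smul,
    L2.integral_congr (Lp.coeFn_smul c _) ⟨le_rfl, ht.1.trans ht.2⟩ ht]
  exact intervalIntegral.integral_smul c _

-- Under f ↦ l f the squared norms scale by l² but the unsquared terminal term only by l, so the
-- terminal term drops out for large l.
variable {α} in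
theorem norm_sq_volterra_le {F : X →L[ℂ] Z} {c : ℝ} (hT : 0 ≤ T)
    (hc : ∀ (x : ℝ → X) (u : L2 T U) (y : L2 T Y), S.IsGeneralizedTrajectory T x u y →
      x 0 = 0 → c * ‖u‖ ^ 2 ≤ ‖y‖ ^ 2 + ‖F (x T)‖) (f : L2 T U) :
    c * ‖volterra T U (volterra T U f)‖ ^ 2 ≤ ‖outputOp α T f‖ ^ 2 := by
  have hTT : T ∈ Icc 0 T := ⟨hT, le_rfl⟩
  set w := volterra T U (volterra T U f)
  set p := outputOp α T f
  set n := ‖F (position α f T)‖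
  have key : ∀ l : ℝ, 0 < l → l * (c * ‖w‖ ^ 2 - ‖p‖ ^ 2) ≤ n := by
    intro l hl
    have h := hc _ _ _ (isGeneralizedTrajectory_position α ((l : ℂ) • f)) (by simp [position])
    rw [position_smul α _ _ hTT, map_smul, map_smul, map_smul, map_smul, norm_smul, norm_smul,
      norm_smul, Complex.norm_real, Real.norm_of_nonneg hl.le] at h
    change c * (l * ‖w‖) ^ 2 ≤ (l * ‖p‖) ^ 2 + l * n at h
    refine le_of_mul_le_mul_left ?_ hl
    linarith
  by_contra! hlt
  have hd : 0 < c * ‖w‖ ^ 2 - ‖p‖ ^ 2 := by linarith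
  have hn : 0 ≤ n := norm_nonneg _
  -- With this l the left side of `key` is n + 1, which exceeds n.
  have := key ((n + 1) / (c * ‖w‖ ^ 2 - ‖p‖ ^ 2)) (by positivity)
  rw [div_mul_cancel₀ _ hd.ne'] at this
  linarith

/-- The Volterra operator on `L²([0,T]; U × Y)`. -/
def volterraProd (T : ℝ) (U Y : Type*)
    [NormedAddCommGroup U] [InnerProductSpace ℂ U] [CompleteSpace U]
    [NormedAddCommGroup Y] [InnerProductSpace ℂ Y] [CompleteSpace Y] :
    WithLp 2 (L2 T U × L2 T Y) →L[ℂ] WithLp 2 (L2 T U × L2 T Y) :=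
  ((WithLp.prodContinuousLinearEquiv 2 ℂ (L2 T U) (L2 T Y)).symm :
      (L2 T U × L2 T Y) →L[ℂ] WithLp 2 (L2 T U × L2 T Y)) ∘L
    ((volterra T U).prodMap (volterra T Y)) ∘L
    (WithLp.prodContinuousLinearEquiv 2 ℂ (L2 T U) (L2 T Y) :
      WithLp 2 (L2 T U × L2 T Y) →L[ℂ] (L2 T U × L2 T Y))

/-- The pairs `(u, y) ∈ L² × L²` with `𝔇_T u = y`. -/
def regularPairs (T : ℝ) : Submodule ℂ (WithLp 2 (L2 T U × L2 T Y)) where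
  carrier := {q | outputOp α T q.fst = volterra T Y (volterra T Y q.snd)}
  zero_mem' := by simp
  add_mem' {a b} ha hb := by
    simp only [mem_ofPred_eq, WithLp.add_fst, WithLp.add_snd, map_add] at ha hb ⊢
    rw [ha, hb]
  smul_mem' c a ha := by
    simp only [mem_ofPred_eq, WithLp.smul_fst, WithLp.smul_snd, map_smul] at ha ⊢
    rw [ha]

/-- Coercivity is known only after two integrations of (u, y). Density of V(N) in N, for N the space
of pairs with 𝔇_T u = y, undoes them one at a time. -/
theorem coerciveOnInputs_of_coerciveOnTrajectories {F : X →L[ℂ] Z} (hT : 0 < T)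
    (h : CoerciveOnTrajectories S T F) : CoerciveOnInputs α T F := by
  obtain ⟨c, hc0, hc⟩ := h
  set N := regularPairs α T
  set L := volterraProd T U Y
  have hNc : IsClosed (N : Set (WithLp 2 (L2 T U × L2 T Y))) :=
    isClosed_eq (f := fun q : WithLp 2 (L2 T U × L2 T Y) => outputOp α T q.fst)
      (g := fun q : WithLp 2 (L2 T U × L2 T Y) => volterra T Y (volterra T Y q.snd))
      (by fun_prop) (by fun_prop)
  have hmap : ∀ q ∈ N, L q ∈ N := by
    intro q hq
    change outputOp α T (volterra T U q.fst) = volterra T Y (volterra T Y (volterra T Y q.snd))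
    rw [← volterra_outputOp]
    exact congrArg _ hq
  have hdense := le_closure_map_of_accretive N hNc L
    (fun q => by
      rw [WithLp.prod_inner_apply, Complex.add_re]
      exact add_nonneg (volterra_accretive hT.le q.fst) (volterra_accretive hT.le q.snd))
    (fun q r hqr => by
      have h1 := congrArg WithLp.fst hqr
      have h2 := congrArg WithLp.snd hqr
      exact WithLp.ofLp_injective 2 (Prod.ext (volterra_injective hT h1)
        (volterra_injective hT h2))) hmap
  have hbase : ∀ q ∈ N, c * ‖(L (L q)).fst‖ ^ 2 ≤ ‖(L (L q)).snd‖ ^ 2 := by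
    intro q hq
    have := norm_sq_volterra_le (α := α) hT.le hc q.fst
    rwa [show outputOp α T q.fst = _ from hq] at this
  have hclosed : ∀ K : WithLp 2 (L2 T U × L2 T Y) →L[ℂ] WithLp 2 (L2 T U × L2 T Y),
      (∀ q ∈ N, c * ‖(K (L q)).fst‖ ^ 2 ≤ ‖(K (L q)).snd‖ ^ 2) →
      ∀ q ∈ N, c * ‖(K q).fst‖ ^ 2 ≤ ‖(K q).snd‖ ^ 2 := by
    intro K hK q hq
    have hcl : IsClosed {q | c * ‖(K q).fst‖ ^ 2 ≤ ‖(K q).snd‖ ^ 2} :=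
      isClosed_le (by fun_prop) (by fun_prop)
    refine closure_minimal ?_ hcl (hdense hq)
    rintro _ ⟨r, hr, rfl⟩
    exact hK r hr
  -- The inner use, with K = L, passes from L(L q) to L q; the outer one, with the identity, from L
  -- q to q.
  have hfinal := hclosed (ContinuousLinearMap.id ℂ _) (hclosed L hbase)
  refine ⟨c, hc0, fun u z y hu => ?_⟩
  have hmem : (WithLp.toLp 2 (u, y)) ∈ N :=
    eq_volterra_of_secondDeriv_eq hT.le ((isInputOutput_iff α u _).1 hu.2).symm
  have := hfinal _ hmem
  exact le_trans this (le_add_of_nonneg_right (sq_nonneg _))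

/-! ### The terminal value map and the output map -/

theorem inputState_combination (a b : ℂ) (u v : L2 T U) {t : ℝ} (ht : t ∈ Icc 0 T) :
    inputState α t (a • u + b • v) = a • inputState α t u + b • inputState α t v := by
  have h0 : (0 : ℝ) ∈ Icc 0 T := ⟨le_rfl, ht.1.trans ht.2⟩
  rw [inputState_eq, inputState_eq, inputState_eq, ← map_smul, ← map_smul, ← map_add]
  congr 1
  have hi : ∀ w : L2 T U, IntervalIntegrable
      (fun s => S.semigroup.op (t - s).toNNReal (resolventControl α (w s))) volume 0 t := fun w =>
    intervalIntegrable_kernel S.semigroup.continuous_orbit t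
      (integrableOn_resolventControl α w) h0 ht
  have hi' : ∀ (a : ℂ) (w : L2 T U), IntervalIntegrable
      (fun s => a • S.semigroup.op (t - s).toNNReal (resolventControl α (w s))) volume 0 t :=
    fun a w => (hi w).smul a
  unfold mild causalConv
  rw [← intervalIntegral.integral_smul, ← intervalIntegral.integral_smul,
    ← intervalIntegral.integral_add (hi' a u) (hi' b v)]
  have hae : (a • u + b • v : L2 T U) =ᵐ[volume.restrict (Icc (0 : ℝ) T)]
      fun s => a • u s + b • v s := by
    filter_upwards [Lp.coeFn_add (a • u) (b • v), Lp.coeFn_smul a u, Lp.coeFn_smul b v]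
      with s h1 h2 h3
    rw [h1, Pi.add_apply, h2, h3, Pi.smul_apply, Pi.smul_apply]
  refine intervalIntegral.integral_congr_ae ?_
  filter_upwards [ae_uIoc_of_ae_Icc hae h0 ht] with s hs hs'
  rw [hs hs', map_add, map_smul, map_smul, map_add, map_smul, map_smul]

variable {α}

theorem IsTerminalValue.combination (hT : 0 ≤ T) {F : X →L[ℂ] Z} {x₀ x₁ : Extrap α}
    {u v : L2 T U} {z w : Z} (h : IsTerminalValue α F x₀ u z) (h' : IsTerminalValue α F x₁ v w)
    (a b : ℂ) : IsTerminalValue α F (a • x₀ + b • x₁) (a • u + b • v) (a • z + b • w) := by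
  obtain ⟨un, xn, hu, hx, hz⟩ := h
  obtain ⟨vn, yn, hv, hy, hw⟩ := h'
  refine ⟨fun n => a • un n + b • vn n, fun n => a • xn n + b • yn n,
    (hu.const_smul a).add (hv.const_smul b), fun n => ?_, ?_⟩
  · rw [map_add, map_smul, map_smul, hx, hy, inputState_combination α a b _ _ ⟨hT, le_rfl⟩,
      map_add, map_smul, map_smul]
    module
  · simpa only [map_add, map_smul] using (hz.const_smul a).add (hw.const_smul b)

theorem isTerminalValue_zero (hT : 0 ≤ T) (F : X →L[ℂ] Z) :
    IsTerminalValue α F 0 (0 : L2 T U) 0 := by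
  refine ⟨fun _ => 0, fun _ => 0, tendsto_const_nhds, fun n => ?_, by simp⟩
  have := inputState_combination α 0 0 (0 : L2 T U) 0 ⟨hT, le_rfl⟩
  simp only [zero_smul, add_zero] at this
  rw [this, map_zero, map_zero, add_zero]

/-- The relation is the sequential closure of the graph of the unclosed map, so no closability is
needed. -/
theorem isClosed_isTerminalValue (F : X →L[ℂ] Z) (x₀ : Extrap α) :
    IsClosed {p : L2 T U × Z | IsTerminalValue α F x₀ p.1 p.2} := by
  have : {p : L2 T U × Z | IsTerminalValue α F x₀ p.1 p.2} =
      closure {p : L2 T U × Z | ∃ x : X,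
        toExtrap α x = extOp α T.toNNReal x₀ + inputState α T p.1 ∧ p.2 = F x} := by
    ext ⟨u, z⟩
    rw [mem_closure_iff_seq_limit]
    constructor
    · rintro ⟨v, x, hv, hx, hz⟩
      exact ⟨fun n => (v n, F (x n)), fun n => ⟨x n, hx n, rfl⟩, hv.prodMk_nhds hz⟩
    · rintro ⟨p, hp, hlim⟩
      choose x hx hx' using hp
      refine ⟨fun n => (p n).1, x, (continuous_fst.tendsto _).comp hlim, hx, ?_⟩
      simp only [← hx']
      exact (continuous_snd.tendsto _).comp hlim
  rw [this]
  exact isClosed_closure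

/-- ℭ_T is single-valued, so η can be fixed once; what remains is an affine equation in (u, y). -/
theorem isOutput_iff {x₀ : Extrap α} {η : Hm20l T Y} (hη : (x₀, η) ∈ (stateOutput α T).graph)
    (u : L2 T U) (y : L2 T Y) :
    IsOutput α x₀ u y ↔ η + secondDeriv (outputOp α T u) = embedL2 y := by
  constructor
  · rintro ⟨η', ξ, h1, h2, h3⟩
    rwa [LinearPMap.mem_graph_snd_inj _ hη h1 rfl, ← (isInputOutput_iff α u ξ).1 h2]
  · intro h
    exact ⟨η, _, hη, (isInputOutput_iff α u _).2 rfl, h⟩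

theorem isClosed_isOutput {x₀ : Extrap α} {η : Hm20l T Y}
    (hη : (x₀, η) ∈ (stateOutput α T).graph) :
    IsClosed {p : L2 T U × L2 T Y | IsOutput α x₀ p.1 p.2} := by
  simp only [isOutput_iff hη]
  exact isClosed_eq (continuous_const.add ((continuous_pairDeriv 2).comp (by fun_prop)))
    ((continuous_pairDeriv 0).comp (by fun_prop))

theorem IsOutput.midpoint {x₀ : Extrap α} {u v : L2 T U} {y w : L2 T Y}
    (h : IsOutput α x₀ u y) (h' : IsOutput α x₀ v w) :
    IsOutput α x₀ ((2⁻¹ : ℂ) • u + (2⁻¹ : ℂ) • v) ((2⁻¹ : ℂ) • y + (2⁻¹ : ℂ) • w) := by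
  obtain ⟨η, -, hη, -⟩ := id h
  rw [isOutput_iff hη] at h h' ⊢
  simp only [map_add, map_smul, ← h, ← h']
  module

theorem IsOutput.isInputOutput_sub {x₀ : Extrap α} {u v : L2 T U} {y w : L2 T Y}
    (h : IsOutput α x₀ u y) (h' : IsOutput α x₀ v w) :
    IsInputOutput α (u - v) (embedL2 (y - w)) := by
  obtain ⟨η, -, hη, -⟩ := id h
  rw [isOutput_iff hη] at h h'
  rw [isInputOutput_iff, map_sub, map_sub, map_sub, ← h, ← h', add_sub_add_left_eq_sub]

/-- The contribution of x₀ cancels. Both the bound on minimising inputs and the uniqueness argument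
pass through this difference. -/
theorem isInputMapValue_sub (hT : 0 ≤ T) {F : X →L[ℂ] Z} {x₀ : Extrap α} {u v : L2 T U}
    {z z' : Z} {y w : L2 T Y} (h : IsTerminalValue α F x₀ u z) (h' : IsTerminalValue α F x₀ v z')
    (hy : IsOutput α x₀ u y) (hw : IsOutput α x₀ v w) :
    IsInputMapValue α F (u - v) (z - z') (y - w) := by
  refine ⟨?_, hy.isInputOutput_sub hw⟩
  have := h.combination hT h' 1 (-1)
  simpa only [one_smul, neg_smul, ← sub_eq_add_neg, sub_self] using this

/-! ### Optimal controls -/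

/-- The triples `(u, (z, y))` with `u ∈ 𝓤_ad`, `z ∈ 𝔗_{F,T}(x₀, u)` and
`y = ℭ_T x₀ + 𝔇_T u`. -/
def admissible (F : X →L[ℂ] Z) (x₀ : Extrap α) (Uad : Set (L2 T U)) :
    Set (L2 T U × WithLp 2 (Z × L2 T Y)) :=
  {p | p.1 ∈ Uad ∧ IsTerminalValue α F x₀ p.1 p.2.fst ∧ IsOutput α x₀ p.1 p.2.snd}

theorem isClosed_admissible (F : X →L[ℂ] Z) (x₀ : Extrap α) {Uad : Set (L2 T U)}
    (hU : IsClosed Uad) : IsClosed (admissible F x₀ Uad) := by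
  by_cases h : ∃ η : Hm20l T Y, (x₀, η) ∈ (stateOutput α T).graph
  · obtain ⟨η, hη⟩ := h
    refine (hU.preimage continuous_fst).inter (IsClosed.inter ?_ ?_)
    · exact (isClosed_isTerminalValue F x₀).preimage
        (f := fun p : L2 T U × WithLp 2 (Z × L2 T Y) => (p.1, p.2.fst)) (by fun_prop)
    · exact (isClosed_isOutput hη).preimage
        (f := fun p : L2 T U × WithLp 2 (Z × L2 T Y) => (p.1, p.2.snd)) (by fun_prop)
  · have : admissible F x₀ Uad = ∅ := by
      refine eq_empty_of_forall_notMem fun p hp => h ?_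
      obtain ⟨η, -, hη, -⟩ := hp.2.2
      exact ⟨η, hη⟩
    rw [this]
    exact isClosed_empty

theorem midpoint_mem_admissible (hT : 0 ≤ T) (F : X →L[ℂ] Z) (x₀ : Extrap α)
    {Uad : Set (L2 T U)} (hU : Convex ℝ Uad) {p q : L2 T U × WithLp 2 (Z × L2 T Y)}
    (hp : p ∈ admissible F x₀ Uad) (hq : q ∈ admissible F x₀ Uad) :
    (2⁻¹ : ℂ) • (p + q) ∈ admissible F x₀ Uad := by
  have h2 : (2⁻¹ : ℂ) + 2⁻¹ = 1 := by norm_num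
  rw [smul_add]
  refine ⟨?_, ?_, hp.2.2.midpoint hq.2.2⟩
  · have h := hU hp.1 hq.1 (show (0 : ℝ) ≤ 2⁻¹ by norm_num) (show (0 : ℝ) ≤ 2⁻¹ by norm_num)
      (by norm_num)
    have hs : ∀ w : L2 T U, (2⁻¹ : ℂ) • w = (2⁻¹ : ℝ) • w := fun w => by
      rw [RCLike.real_smul_eq_coe_smul (K := ℂ)]
      norm_num
    change (2⁻¹ : ℂ) • p.1 + (2⁻¹ : ℂ) • q.1 ∈ Uad
    rwa [hs, hs]
  · have := hp.2.1.combination hT hq.2.1 2⁻¹ 2⁻¹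
    rwa [← add_smul, h2, one_smul] at this

theorem exists_min_admissible [CompleteSpace Z] (hT : 0 ≤ T) {F : X →L[ℂ] Z} {x₀ : Extrap α}
    {Uad : Set (L2 T U)} (hcl : IsClosed Uad) (hU : Convex ℝ Uad)
    (hco : Bornology.IsBounded Uad ∨ CoerciveOnInputs α T F)
    (hne : (admissible (Y := Y) (S := S) F x₀ Uad).Nonempty) (e : WithLp 2 (Z × L2 T Y)) :
    ∃ p ∈ admissible F x₀ Uad, ∀ q ∈ admissible F x₀ Uad, ‖p.2 - e‖ ≤ ‖q.2 - e‖ := by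
  refine exists_min_norm_snd_sub _ hne (isClosed_admissible F x₀ hcl)
    (fun p hp q hq => midpoint_mem_admissible hT F x₀ hU hp hq) (fun r => ?_) e
  rcases hco with hb | ⟨c, hc0, hc⟩
  · obtain ⟨R, hR⟩ := hb.exists_norm_le
    exact ⟨R, fun p hp _ => hR _ hp.1⟩
  · obtain ⟨q, hq⟩ := hne
    -- Coercivity applied to p - q for a fixed admissible q bounds ‖p.1 - q.1‖ by the square root.
    refine ⟨√((r + ‖q.2‖) ^ 2 / c) + ‖q.1‖, fun p hp hpr => ?_⟩
    have h1 := hc _ _ _ (isInputMapValue_sub hT hp.2.1 hq.2.1 hp.2.2 hq.2.2)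
    have h2 : ‖p.2.snd - q.2.snd‖ ^ 2 + ‖p.2.fst - q.2.fst‖ ^ 2 = ‖p.2 - q.2‖ ^ 2 := by
      rw [WithLp.prod_norm_sq_eq_of_L2, add_comm]
      rfl
    have h3 : ‖p.2 - q.2‖ ≤ r + ‖q.2‖ := (norm_sub_le _ _).trans (by gcongr)
    have h4 : ‖p.1 - q.1‖ ≤ √((r + ‖q.2‖) ^ 2 / c) := by
      refine Real.le_sqrt_of_sq_le ((le_div_iff₀' hc0).2 (h1.trans (h2.trans_le ?_)))
      gcongr
    have h5 := norm_sub_norm_le p.1 q.1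
    linarith

theorem cost_le {F : X →L[ℂ] Z} {x₀ : Extrap α} {Uad : Set (L2 T U)} (e : WithLp 2 (Z × L2 T Y))
    {p : L2 T U × WithLp 2 (Z × L2 T Y)} (hp : p ∈ admissible F x₀ Uad) :
    cost α F x₀ e.fst e.snd p.1 ≤ ENNReal.ofReal (‖p.2 - e‖ ^ 2 / 2) := by
  refine (iInf₂_le p.2.fst p.2.snd).trans ((iInf₂_le hp.2.1 hp.2.2).trans_eq ?_)
  rw [WithLp.prod_norm_sq_eq_of_L2]
  rfl

/-- With `cost_le`, this identifies the cost of u with an infimum over admissible triples above u;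
for lack of such triples it is ∞. -/
theorem le_cost {F : X →L[ℂ] Z} {x₀ : Extrap α} {Uad : Set (L2 T U)} {e : WithLp 2 (Z × L2 T Y)}
    {u : L2 T U} (hu : u ∈ Uad) {b : ℝ≥0∞}
    (h : ∀ p ∈ admissible F x₀ Uad, p.1 = u → b ≤ ENNReal.ofReal (‖p.2 - e‖ ^ 2 / 2)) :
    b ≤ cost α F x₀ e.fst e.snd u := by
  refine le_iInf₂ fun z y => le_iInf₂ fun hz hy => ?_
  refine (h (u, WithLp.toLp 2 (z, y)) ⟨hu, hz, hy⟩ rfl).trans_eq ?_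
  rw [WithLp.prod_norm_sq_eq_of_L2]
  rfl

theorem existsUnique_isOptimalControl [CompleteSpace Z] (hT : 0 ≤ T) {F : X →L[ℂ] Z} {x₀ : Extrap α}
    {Uad : Set (L2 T U)} (hcl : IsClosed Uad) (hU : Convex ℝ Uad)
    (hco : Bornology.IsBounded Uad ∨ CoerciveOnInputs α T F)
    (hne : (admissible (Y := Y) (S := S) F x₀ Uad).Nonempty)
    (hinj : InputMapInjective α T F) (zf : Z) (yref : L2 T Y) :
    ∃! u, IsOptimalControl α F x₀ zf yref Uad u := by
  set e : WithLp 2 (Z × L2 T Y) := WithLp.toLp 2 (zf, yref)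
  obtain ⟨p, hp, hmin⟩ := exists_min_admissible hT hcl hU hco hne e
  have hlow : ∀ v ∈ Uad, ENNReal.ofReal (‖p.2 - e‖ ^ 2 / 2) ≤ cost α F x₀ zf yref v :=
    fun v hv => le_cost (e := e) hv fun q hq _ => by
      have := hmin q hq
      gcongr
  have hpc : cost α F x₀ zf yref p.1 ≤ ENNReal.ofReal (‖p.2 - e‖ ^ 2 / 2) := cost_le e hp
  refine ⟨p.1, ⟨hp.1, le_antisymm (le_iInf₂ fun v hv => hpc.trans (hlow v hv))
    (iInf₂_le p.1 hp.1)⟩, ?_⟩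
  rintro u ⟨hu, huo⟩
  have huc : cost α F x₀ zf yref u ≤ ENNReal.ofReal (‖p.2 - e‖ ^ 2 / 2) :=
    huo.trans_le ((iInf₂_le p.1 hp.1).trans hpc)
  -- An optimal u has finite cost, whereas an infimum over no triples would be ∞.
  have hne' : (admissible (Y := Y) (S := S) F x₀ {u}).Nonempty := by
    by_contra hempty
    rw [not_nonempty_iff_eq_empty] at hempty
    have : (⊤ : ℝ≥0∞) ≤ cost α F x₀ zf yref u :=
      le_cost (e := e) (mem_singleton u) fun q hq _ => by simp [hempty] at hq
    exact ENNReal.ofReal_ne_top (top_le_iff.1 (this.trans huc))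
  -- The cost of u is an infimum over possibly many terminal values. The existence result for the
  -- bounded set {u} shows that it is attained.
  obtain ⟨q, hq, hqmin⟩ := exists_min_admissible hT isClosed_singleton (convex_singleton u)
    (.inl Bornology.isBounded_singleton) hne' e
  have hqu : q.1 = u := hq.1
  have hqU : q ∈ admissible F x₀ Uad := ⟨hqu ▸ hu, hq.2⟩
  have hqp : ‖q.2 - e‖ ≤ ‖p.2 - e‖ := by
    have h1 : ENNReal.ofReal (‖q.2 - e‖ ^ 2 / 2) ≤ cost α F x₀ zf yref u :=
      le_cost (e := e) (mem_singleton u) fun r hr _ => by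
        have := hqmin r hr
        gcongr
    have h2 := (ENNReal.ofReal_le_ofReal_iff (by positivity)).1 (h1.trans huc)
    exact (pow_le_pow_iff_left₀ (norm_nonneg _) (norm_nonneg _) two_ne_zero).1 (by linarith)
  have hmid := hmin _ (midpoint_mem_admissible hT F x₀ hU hp hqU)
  -- Neither p nor q is farther from e than their midpoint, so the parallelogram law forces the
  -- distance of p.2 and q.2 to be zero.
  have heq : p.2 = q.2 := by
    have h1 := norm_sub_sq_eq_midpoint (p.2 - e) (q.2 - e)
    have h2 : ((2⁻¹ : ℂ) • (p + q)).2 - e = (2⁻¹ : ℂ) • ((p.2 - e) + (q.2 - e)) := by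
      rw [Prod.smul_snd, Prod.snd_add]
      module
    rw [h2] at hmid
    rw [sub_sub_sub_cancel_right] at h1
    have h3 := pow_le_pow_left₀ (norm_nonneg _) hmid 2
    have h4 := pow_le_pow_left₀ (norm_nonneg _) hqp 2
    have h5 : ‖p.2 - q.2‖ ^ 2 ≤ 0 := by linarith
    exact sub_eq_zero.1 (norm_eq_zero.1 (pow_eq_zero_iff two_ne_zero |>.1
      (le_antisymm h5 (sq_nonneg _))))
  -- The input p.1 - q.1 has the value (0, 0), which the input 0 has as well.
  have hv := isInputMapValue_sub hT hp.2.1 hqU.2.1 hp.2.2 hqU.2.2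
  rw [heq, sub_self, sub_self] at hv
  have h0 : IsInputMapValue α F (0 : L2 T U) 0 (0 : L2 T Y) := by
    refine ⟨isTerminalValue_zero hT F, (isInputOutput_iff α _ _).2 ?_⟩
    simp only [map_zero]
  rw [← hqu]
  exact (sub_eq_zero.1 (hinj _ _ _ _ hv h0)).symm

end SystemNode

end OptControl
end

theorem mainTheorem3 {X U Y Z : Type*}
    [NormedAddCommGroup X] [InnerProductSpace ℂ X] [CompleteSpace X]
    [NormedAddCommGroup U] [InnerProductSpace ℂ U] [CompleteSpace U]
    [NormedAddCommGroup Y] [InnerProductSpace ℂ Y] [CompleteSpace Y]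
    [NormedAddCommGroup Z] [InnerProductSpace ℂ Z] [CompleteSpace Z]
    (T : ℝ) (hT : 0 < T)
    (S : OptControl.SystemNode X U Y) (α : S.ResolventPoint)
    (F : X →L[ℂ] Z)
    (hF : Dense (OptControl.SystemNode.adjointRegularSet α T F))
    (x₀ : OptControl.SystemNode.Extrap α) (zf : Z) (yref : OptControl.L2 T Y)
    (Uad : Set (OptControl.L2 T U)) (hUclosed : IsClosed Uad) (hUconvex : Convex ℝ Uad)
    (hcoercive : Bornology.IsBounded Uad ∨
      OptControl.SystemNode.CoerciveOnTrajectories S T F ∨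
      OptControl.SystemNode.CoerciveOnInputs α T F)
    (hfeasible : ∃ u ∈ Uad,
      (∃ z, OptControl.SystemNode.IsTerminalValue α F x₀ u z) ∧
      ∃ y, OptControl.SystemNode.IsOutput α x₀ u y)
    (hinj : OptControl.SystemNode.InputMapInjective α T F) :
    ∃! u, OptControl.SystemNode.IsOptimalControl α F x₀ zf yref Uad u := by
  obtain ⟨u, hu, ⟨z, hz⟩, y, hy⟩ := hfeasible
  refine OptControl.SystemNode.existsUnique_isOptimalControl hT.le hUclosed hUconvex ?_
    ⟨(u, WithLp.toLp 2 (z, y)), hu, hz, hy⟩ hinj zf yref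
  rcases hcoercive with h | h | h
  · exact .inl h
  · exact .inr (OptControl.SystemNode.coerciveOnInputs_of_coerciveOnTrajectories α hT h)
  · exact .inr h
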